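/- Work over $\mathbb{C}(q)$, fix $\iota=\sqrt{-1}\in\mathbb{C}$, and for $n\in\mathbb{Z}$, $\mu\in\mathbb{C}(q)^*$ put $[n]=\frac{q^n-q^{-n}}{q-q^{-1}}$ and $[\mu;n]=\frac{q^n\mu-q^{-n}\mu^{-1}}{q-q^{-1}}$. Let $U_q'=U_q'(\mathfrak{gl}_2\times\mathfrak{gl}_2)$ be the quantum symmetric pair coideal subalgebra of $U_q(\mathfrak{gl}_4)$, presented as the $\mathbb{C}(q)$-algebra with generators $B_0,B_1,B_{-1},\hat D_\diamondsuit^{\pm1},\hat D_1^{\pm1}$ and the following relations: $\hat D_\diamondsuit,\hat D_1$ are invertible (with inverses $\hat D_\diamondsuit^{-1},\hat D_1^{-1}$) and commute with each other and with $B_0$; $$\hat D_\diamondsuit B_{\pm1}=q^{\pm1}B_{\pm1}\hat D_\diamondsuit,\qquad \hat D_1B_{\pm1}=q^{\mp1}B_{\pm1}\hat D_1,\qquad B_1B_{-1}-B_{-1}B_1=\frac{\hat D_\diamondsuit\hat D_1^{-1}-\hat D_1\hat D_\diamondsuit^{-1}}{q-q^{-1}},$$ $$B_0^2B_{\pm1}-[2]B_0B_{\pm1}B_0+B_{\pm1}B_0^2=B_{\pm1},\qquad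 B_{\pm1}^2B_0-[2]B_{\pm1}B_0B_{\pm1}+B_0B_{\pm1}^2=0.$$ Put $X=B_0B_1-q^{-1}B_1B_0$, $Y=B_0B_{-1}-q^{-1}B_{-1}B_0$, $Z=B_1Y-q^{-1}YB_1$. For $\kappa_\diamondsuit,\kappa_1\in\mathbb{Z}$ and $\beta,\zeta\in\mathbb{C}(q)$ let $\mathbb{M}(\kappa_\diamondsuit,\kappa_1,\beta,\zeta)$ be the Verma module, i.e. the left $U_q'$-module induced from the one-dimensional representation of the subalgebra generated by $B_1,X,\hat D_\diamondsuit^{\pm1},\hat D_1^{\pm1},B_0,Z$ on which $B_1,X$ act by $0$ and $\hat D_\diamondsuit,\hat D_1,B_0,Z$ act by $q^{\kappa_\diamondsuit},q^{\kappa_1},\beta,\zeta$. **Theorem.** Let $\mu,\mu'\in\mathbb{C}(q)^*$, $\zeta,\zeta'\in\mathbb{C}(q)$ and $\kappa_\diamondsuit,\kappa_1,\kappa_\diamondsuit',\kappa_1'\in\mathbb{Z}$, put $\kappa=\kappa_\diamondsuit-\kappa_1$, and suppose that $M=\mathbb{M}(\kappa_\diamondsuit,\kappa_1,[\mu;0],\zeta)$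 is good, i.e. $\mu\ne\pm q^l\iota$ for all $l\in\mathbb{Z}$. Then $\operatorname{Hom}_{U_q'}(\mathbb{M}(\kappa_\diamondsuit',\kappa_1',[\mu';0],\zeta'),M)$ is nonzero if and only if there exists $i\in\mathbb{Z}_{\ge0}$ such that one of the following holds: 1. $\zeta=\mu q^{-i}[\kappa-i]-\mu^{-1}q^{i-\kappa}[i]$, $\kappa_\diamondsuit'=\kappa_\diamondsuit-i-1$, $\kappa_1'=\kappa_1+i+1$, $[\mu';0]=[\mu;-(i+1)]$, $\zeta'=\mu q[\kappa-i]+\mu^{-1}q^{2i+1-\kappa}[i+2]$; 2. $\zeta=\mu q^{i-\kappa}[i]-\mu^{-1}q^{-i}[\kappa-i]$, $\kappa_\diamondsuit'=\kappa_\diamondsuit-i-1$, $\kappa_1'=\kappa_1+i+1$, $[\mu';0]=[\mu;i+1]$, $\zeta'=-\mu q^{2i+1-\kappa}[i+2]-\mu^{-1}q[\kappa-i]$; 3. $0\le i\le\kappa$, $\zeta=\mu q^{-i}[\kappa-i]-\mu^{-1}q^{i-\kappa}[i]$, $\kappa_\diamondsuit'=\kappa_1-2$, $\kappa_1'=\kappa_\diamondsuit+2$,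 $[\mu';0]=[\mu;\kappa-2i]$, $\zeta'=\mu^{-1}q^{i+2}[i+2]-\mu q^{\kappa-i+2}[\kappa-i+2]$; 4. $(\kappa_\diamondsuit',\kappa_1',[\mu';0],\zeta')=(\kappa_\diamondsuit,\kappa_1,[\mu;0],\zeta)$. If this Hom space is nonzero, it is one-dimensional over $\mathbb{C}(q)$. -/

import Mathlib

noncomputable section

namespace QSP

/-- The ground field `ℂ(q)`. -/
abbrev Kq : Type := RatFunc ℂ

/-- The variable `q` of `ℂ(q)`. -/
def q : Kq := RatFunc.X

/-- The chosen square root `ι` of `-1`, as a constant of `ℂ(q)`. -/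
def iota : Kq := RatFunc.C Complex.I

/-- The quantum integer `[n] = (q^n - q^{-n}) / (q - q^{-1})` for `n : ℤ`. -/
def qint (n : ℤ) : Kq := (q ^ n - q ^ (-n)) / (q - q⁻¹)

/-- `[μ; n] = (q^n μ - q^{-n} μ⁻¹) / (q - q^{-1})`, meant for `μ ≠ 0`. -/
def qbr (μ : Kq) (n : ℤ) : Kq := (q ^ n * μ - q ^ (-n) * μ⁻¹) / (q - q⁻¹)

/-- Generators of `U_q'`: `b0, b1, bm1` stand for `B_0, B_1, B_{-1}`, `dd, ddInv` for
`D̂_◇, D̂_◇⁻¹` and `d1, d1Inv` for `D̂_1, D̂_1⁻¹`. -/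
inductive Gen : Type
  | b0 | b1 | bm1 | dd | ddInv | d1 | d1Inv

/-- The free associative algebra on the generators. -/
abbrev Free : Type := FreeAlgebra Kq Gen

/-- A generator as an element of the free algebra. -/
abbrev gen (g : Gen) : Free := FreeAlgebra.ι Kq g

open Gen in
/-- The defining relations of `U_q'`. With `K̂ = D̂_◇ D̂_1⁻¹`, the elements `B_1, B_{-1}, D̂_◇, D̂_1`
satisfy the relations of `U_q(gl_2)`, with `B_1` in the role of `E` and `B_{-1}` in the role of `F`;
`B_0` commutes with `D̂_◇, D̂_1`; and `B_0, B_{±1}` satisfy the (inhomogeneous) quantum Serre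
relations. -/
inductive Rel : Free → Free → Prop
  | dd_inv : Rel (gen dd * gen ddInv) 1
  | inv_dd : Rel (gen ddInv * gen dd) 1
  | d1_inv : Rel (gen d1 * gen d1Inv) 1
  | inv_d1 : Rel (gen d1Inv * gen d1) 1
  | dd_d1 : Rel (gen dd * gen d1) (gen d1 * gen dd)
  | dd_b1 : Rel (gen dd * gen b1) (q • (gen b1 * gen dd))
  | dd_bm1 : Rel (gen dd * gen bm1) (q⁻¹ • (gen bm1 * gen dd))
  | d1_b1 : Rel (gen d1 * gen b1) (q⁻¹ • (gen b1 * gen d1))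
  | d1_bm1 : Rel (gen d1 * gen bm1) (q • (gen bm1 * gen d1))
  | dd_b0 : Rel (gen dd * gen b0) (gen b0 * gen dd)
  | d1_b0 : Rel (gen d1 * gen b0) (gen b0 * gen d1)
  | b1_bm1 : Rel (gen b1 * gen bm1 - gen bm1 * gen b1)
      ((q - q⁻¹)⁻¹ • (gen dd * gen d1Inv - gen d1 * gen ddInv))
  | serre_b0_b1 : Rel
      (gen b0 * gen b0 * gen b1 - qint 2 • (gen b0 * gen b1 * gen b0) + gen b1 * gen b0 * gen b0)
      (gen b1)
  | serre_b0_bm1 : Rel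
      (gen b0 * gen b0 * gen bm1 - qint 2 • (gen b0 * gen bm1 * gen b0)
        + gen bm1 * gen b0 * gen b0)
      (gen bm1)
  | serre_b1_b0 : Rel
      (gen b1 * gen b1 * gen b0 - qint 2 • (gen b1 * gen b0 * gen b1) + gen b0 * gen b1 * gen b1)
      0
  | serre_bm1_b0 : Rel
      (gen bm1 * gen bm1 * gen b0 - qint 2 • (gen bm1 * gen b0 * gen bm1)
        + gen b0 * gen bm1 * gen bm1)
      0

/-- The quantum symmetric pair algebra `U_q' = U_q'(gl_2 × gl_2)`, by its presentation. -/
abbrev Uq' : Type := RingQuot Rel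

/-- The image of a generator in `U_q'`. -/
def u (g : Gen) : Uq' := RingQuot.mkAlgHom Kq Rel (gen g)

def B0 : Uq' := u Gen.b0
def B1 : Uq' := u Gen.b1
def Bm1 : Uq' := u Gen.bm1
/-- `D̂_◇`. -/
def Dd : Uq' := u Gen.dd
/-- `D̂_1`. -/
def D1 : Uq' := u Gen.d1

/-- The `p`-commutator `[A, B]_p = A B - p B A`. -/
def qcomm (p : Kq) (A B : Uq') : Uq' := A * B - p • (B * A)

/-- `X = [B_0, B_1]_{q⁻¹}`. -/
def X : Uq' := qcomm q⁻¹ B0 B1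
/-- `Y = [B_0, B_{-1}]_{q⁻¹}`. -/
def Y : Uq' := qcomm q⁻¹ B0 Bm1
/-- `Z = [B_1, Y]_{q⁻¹}`. -/
def Z : Uq' := qcomm q⁻¹ B1 Y

/-- The left ideal of `U_q'` generated by `B_1`, `X`, `D̂_◇ - q^κ_◇`, `D̂_1 - q^κ_1`, `B_0 - β`
and `Z - ζ`. -/
def vermaIdeal (κd κ1 : ℤ) (β ζ : Kq) : Submodule Uq' Uq' :=
  Submodule.span Uq'
    {B1, X, Dd - algebraMap Kq Uq' (q ^ κd), D1 - algebraMap Kq Uq' (q ^ κ1),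
      B0 - algebraMap Kq Uq' β, Z - algebraMap Kq Uq' ζ}

/-- The Verma module `M(κ_◇, κ_1, β, ζ)`: the left `U_q'`-module induced from the one-dimensional
representation of the subalgebra generated by `B_1, X, D̂_◇^{±1}, D̂_1^{±1}, B_0, Z` on which these
generators act by `0, 0, q^{±κ_◇}, q^{±κ_1}, β, ζ`. Since `A / J` induces to `U_q' / U_q' J` for a
left ideal `J` of a subalgebra `A`, it is the quotient of `U_q'` by the left ideal above; the
highest weight vector `1 ⊗ 1` is the class of `1`. -/
abbrev Verma (κd κ1 : ℤ) (β ζ : Kq) : Type :=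
  Uq' ⧸ vermaIdeal κd κ1 β ζ

/-- The condition on `μ` (nonzero) under which `M(κ_◇, κ_1, [μ;0], ζ)` is a good Verma module. -/
def IsGood (μ : Kq) : Prop :=
  ∀ l : ℤ, μ ≠ q ^ l * iota ∧ μ ≠ -(q ^ l * iota)

/-- `Hom_{U_q'}` between two Verma modules; a vector space over `ℂ(q)`. -/
abbrev VermaHom (κd' κ1' : ℤ) (β' ζ' : Kq) (κd κ1 : ℤ) (β ζ : Kq) : Type :=
  Verma κd' κ1' β' ζ' →ₗ[Uq'] Verma κd κ1 β ζ

end QSP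

end

namespace QSP

noncomputable section

/-! Write `{n} = q^n μ + q^{-n} μ⁻¹` (this is `qpl μ n`). On a `B_0`-eigenvector of eigenvalue
`[μ;n]`, the Serre relation quadratic in `B_0` says that `B_{-1}` lands in the sum of the
eigenspaces for `[μ;n+1]` and `[μ;n-1]`. When `μ` is good, the `[μ;n]` are distinct and the `{n} =
[μ;n+1] - [μ;n-1]` are nonzero, so `B_{-1}` splits into a raising and a lowering part. By the other
Serre relation these parts commute, up to the normalisation built into `vec`. Applying them `a` and
`b` times to the highest weight vector gives vectors indexed by `(a, b)`, with `B_0`-eigenvalue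
`[μ;a-b]` and `D̂_◇`-eigenvalue `q^(κ_◇-a-b)`.

These vectors form a basis. They span because `B_1` acts by explicit coefficients
(`IsHighest.b1_vec`): the error in the formula is shown to vanish by induction on `a + b`. They are
independent because the same formulas define a representation on a lattice indexed by `ℤ × ℤ`
(`freeRep_rel`), into which the Verma module maps with `(a, b)` going to the basis vector `W a b`
(`toLattice_injective`).

A nonzero homomorphism is the choice of a nonzero singular vector. The joint spectrum of `D̂_◇` and
`B_0` is simple, so such a vector is a multiple of one basis vector (`eq_smul_basisVec`), and the
Hom space is at most a line. The basis vector at `(a, b)` is killed by `B_1` exactly when both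
coefficients vanish: `a = 0` or `ζ = ζ⁺(a-1)`, and `b = 0` or `ζ = ζ⁻(b-1)`, where `ζ⁺` and `ζ⁻` are
`zetaPlus` and `zetaMinus`. The four combinations are the four cases of the theorem, and `zEigen`
supplies `ζ'`. -/

instance natAlgebraKq : Algebra ℕ Kq := Semiring.toNatAlgebra

instance intAlgebraKq : Algebra ℤ Kq := Ring.toIntAlgebra _

/-! ### Powers of `q`, goodness, and identities between quantum brackets. -/

theorem q_ne_zero : q ≠ 0 := RatFunc.X_ne_zero

theorem intDegree_zpow {x : Kq} (hx : x ≠ 0) (n : ℤ) :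
    (x ^ n).intDegree = n * x.intDegree := by
  have hnat : ∀ m : ℕ, (x ^ m).intDegree = m * x.intDegree := by
    intro m
    induction m with
    | zero => simp
    | succ k ih =>
      rw [pow_succ, RatFunc.intDegree_mul (pow_ne_zero _ hx) hx, ih]
      push_cast
      ring
  obtain ⟨m, rfl | rfl⟩ := n.eq_nat_or_neg
  · simpa using hnat m
  · rw [zpow_neg, zpow_natCast, RatFunc.intDegree_inv, hnat]
    ring

theorem intDegree_q_zpow (n : ℤ) : (q ^ n).intDegree = n := by
  rw [intDegree_zpow q_ne_zero, q, RatFunc.intDegree_X, mul_one]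

theorem q_zpow_injective {m n : ℤ} (h : q ^ m = q ^ n) : m = n := by
  rw [← intDegree_q_zpow m, h, intDegree_q_zpow]

theorem q_sub_inv_ne_zero : q - q⁻¹ ≠ 0 := by
  intro h
  have : q ^ (1 : ℤ) = q ^ (-1 : ℤ) := by
    rw [zpow_one, zpow_neg, zpow_one]
    exact sub_eq_zero.mp h
  have := q_zpow_injective this
  omega

theorem q_sq_sub_one_ne_zero : q ^ 2 - 1 ≠ 0 := by
  intro h
  apply q_sub_inv_ne_zero
  have := q_ne_zero
  field_simp
  rw [h, mul_zero]

theorem q_add_neg_inv : q + -q⁻¹ = (q ^ 2 - 1) / q := by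
  have := q_ne_zero
  field_simp
  ring

theorem qint_ne_zero {n : ℤ} (hn : n ≠ 0) : qint n ≠ 0 := by
  refine div_ne_zero (fun h => hn ?_) q_sub_inv_ne_zero
  have := q_zpow_injective (sub_eq_zero.mp h)
  omega

theorem qint_zero : qint 0 = 0 := by simp [qint]

theorem qint_one : qint 1 = 1 := by
  rw [qint, zpow_neg, zpow_one, div_self q_sub_inv_ne_zero]

/-- `q^n μ + q^{-n} μ⁻¹`. -/
def qpl (μ : Kq) (n : ℤ) : Kq := q ^ n * μ + q ^ (-n) * μ⁻¹

/-- Comparing degrees in `μ² = -q^m` forces `m = 2 deg μ`, so `μ = ± q^(deg μ) ι`. All uses of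
goodness go through this form. -/
theorem IsGood.sq_ne {μ : Kq} (hμ : μ ≠ 0) (h : IsGood μ) (m : ℤ) : μ ^ 2 ≠ -q ^ m := by
  intro e
  have hI : iota ^ 2 = -1 := by
    rw [iota, ← map_pow, Complex.I_sq, map_neg, map_one]
  have hd := congrArg RatFunc.intDegree e
  rw [RatFunc.intDegree_neg, intDegree_q_zpow, pow_two, RatFunc.intDegree_mul hμ hμ] at hd
  have e2 : μ ^ 2 = (q ^ μ.intDegree * iota) ^ 2 := by
    rw [e, mul_pow, hI, ← hd, zpow_add₀ q_ne_zero]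
    ring
  rcases sq_eq_sq_iff_eq_or_eq_neg.mp e2 with h1 | h1
  · exact (h _).1 h1
  · exact (h _).2 h1

theorem qpl_ne_zero {μ : Kq} (hμ : μ ≠ 0) (h : IsGood μ) (n : ℤ) : qpl μ n ≠ 0 := by
  intro e
  apply h.sq_ne hμ (-n - n)
  have hq := zpow_ne_zero n q_ne_zero
  rw [qpl, zpow_neg] at e
  rw [zpow_sub₀ q_ne_zero, zpow_neg]
  field_simp at e ⊢
  linear_combination e

theorem qbr_injective {μ : Kq} (hμ : μ ≠ 0) (h : IsGood μ) {m n : ℤ}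
    (e : qbr μ m = qbr μ n) : m = n := by
  by_contra hne
  apply h.sq_ne hμ (-m - n)
  have h1 := zpow_ne_zero m q_ne_zero
  have h2 := zpow_ne_zero n q_ne_zero
  have h3 : q ^ m - q ^ n ≠ 0 := fun h => hne (q_zpow_injective (sub_eq_zero.mp h))
  rw [qbr, qbr, div_left_inj' q_sub_inv_ne_zero, zpow_neg, zpow_neg] at e
  rw [zpow_sub₀ q_ne_zero, zpow_neg]
  field_simp at e
  have h4 : (q ^ m - q ^ n) * (q ^ m * q ^ n * μ ^ 2 + 1) = 0 := by linear_combination e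
  have h5 := (mul_eq_zero.mp h4).resolve_left h3
  field_simp
  linear_combination h5

/-- The value of `ζ` for which `(B_-)^{i+1}` times the highest weight vector is singular, where
`B_-` lowers the `B_0`-weight `[μ; n]` to `[μ; n - 1]`. -/
def zetaMinus (κ : ℤ) (μ : Kq) (i : ℤ) : Kq :=
  μ * q ^ (-i) * qint (κ - i) - μ⁻¹ * q ^ (i - κ) * qint i

/-- The value of `ζ` for which `(B_+)^{i+1}` times the highest weight vector is singular, where
`B_+` raises the `B_0`-weight `[μ; n]` to `[μ; n + 1]`. -/
def zetaPlus (κ : ℤ) (μ : Kq) (i : ℤ) : Kq :=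
  μ * q ^ (i - κ) * qint i - μ⁻¹ * q ^ (-i) * qint (κ - i)

/-- The numerator of the coefficient of `W (a - 1) b` in `B_1 W a b`. -/
def coeffPlus (κ : ℤ) (μ ζ : Kq) (a : ℤ) : Kq :=
  qint a * qpl μ a * (ζ - zetaPlus κ μ (a - 1))

/-- The numerator of the coefficient of `W a (b - 1)` in `B_1 W a b`. -/
def coeffMinus (κ : ℤ) (μ ζ : Kq) (b : ℤ) : Kq :=
  -(qint b * qpl μ (-b) * (ζ - zetaMinus κ μ (b - 1)))

/-- This is the `W a b` component of the commutator relation for `B_1` and `B_{-1}`, with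
denominators cleared. -/
theorem coeff_identity (κ : ℤ) {μ : Kq} (hμ : μ ≠ 0) (ζ : Kq) (a b : ℤ) :
    (coeffPlus κ μ ζ (a + 1) - coeffMinus κ μ ζ b) * qpl μ (a - b - 1)
      + (coeffMinus κ μ ζ (b + 1) - coeffPlus κ μ ζ a) * qpl μ (a - b + 1)
      = qint (κ - 2 * (a + b)) * qpl μ (a - b) * qpl μ (a - b + 1) * qpl μ (a - b - 1) := by
  have h0 := q_sq_sub_one_ne_zero
  have hq := q_ne_zero
  have h1 := zpow_ne_zero a q_ne_zero
  have h2 := zpow_ne_zero b q_ne_zero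
  have h3 := zpow_ne_zero κ q_ne_zero
  simp only [coeffPlus, coeffMinus, zetaPlus, zetaMinus, qint, qpl, two_mul, neg_add,
    sub_eq_add_neg, neg_neg, zpow_add₀ hq, zpow_neg, zpow_one]
  generalize q ^ a = x at *
  generalize q ^ b = y at *
  generalize q ^ κ = k at *
  rw [q_add_neg_inv]
  field_simp
  ring

theorem qbr_add_one_sub (μ : Kq) (n : ℤ) : qbr μ (n + 1) - qbr μ (n - 1) = qpl μ n := by
  have h0 := q_sub_inv_ne_zero
  have hq := q_ne_zero
  rw [qbr, qbr, qpl, ← sub_div, div_eq_iff h0]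
  simp only [neg_add, sub_eq_add_neg, neg_neg, zpow_add₀ hq, zpow_neg, zpow_one]
  ring

theorem qbr_add_one_add (μ : Kq) (n : ℤ) :
    qbr μ (n + 1) + qbr μ (n - 1) = qint 2 * qbr μ n := by
  have h0 := q_sub_inv_ne_zero
  have hq := q_ne_zero
  have h2 : qint 2 = q + q⁻¹ := by
    rw [qint, div_eq_iff h0]
    simp only [zpow_neg, zpow_ofNat]
    field_simp
    ring
  rw [h2, qbr, qbr, qbr, ← add_div, ← mul_div_assoc, div_left_inj' h0]
  simp only [neg_add, sub_eq_add_neg, neg_neg, zpow_add₀ hq, zpow_neg, zpow_one]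
  ring

/-- Together with `qbr_add_one_add`, this identifies `[μ;n±1]` as the roots of `t² - [2][μ;n] t +
[μ;n]² - 1`, the polynomial that the Serre relation imposes on `B_0`. -/
theorem qbr_mul {μ : Kq} (hμ : μ ≠ 0) (n : ℤ) :
    qbr μ (n + 1) * qbr μ (n - 1) = qbr μ n ^ 2 - 1 := by
  have h0 := q_sq_sub_one_ne_zero
  have hq := q_ne_zero
  have h1 := zpow_ne_zero n q_ne_zero
  simp only [qbr, neg_add, sub_eq_add_neg, neg_neg, zpow_add₀ hq, zpow_neg, zpow_one]
  generalize q ^ n = x at *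
  rw [q_add_neg_inv]
  field_simp
  ring

theorem two_qbr_sub (μ : Kq) (n : ℤ) :
    2 * qbr μ n - qint 2 * qbr μ (n + 1) = -qpl μ (n + 1) := by
  have h1 := qbr_add_one_add μ (n + 1)
  have h2 := qbr_add_one_sub μ (n + 1)
  rw [add_sub_cancel_right] at h1 h2
  linear_combination h1 - h2

theorem two_qbr_sub' (μ : Kq) (n : ℤ) :
    2 * qbr μ n - qint 2 * qbr μ (n - 1) = qpl μ (n - 1) := by
  have h1 := qbr_add_one_add μ (n - 1)
  have h2 := qbr_add_one_sub μ (n - 1)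
  rw [sub_add_cancel] at h1 h2
  linear_combination h1 + h2

/-- With the next lemma, gives the factors by which `Y` rescales the raising and the lowering part
of `B_{-1}`. -/
theorem qbr_add_one_sub_qinv_mul (μ : Kq) (n : ℤ) :
    qbr μ (n + 1) - q⁻¹ * qbr μ n = q ^ n * μ := by
  have h0 := q_sub_inv_ne_zero
  have hq := q_ne_zero
  rw [qbr, qbr, ← mul_div_assoc, ← sub_div, div_eq_iff h0]
  simp only [neg_add, sub_eq_add_neg, zpow_add₀ hq, zpow_neg, zpow_one]
  ring

theorem qbr_sub_one_sub_qinv_mul (μ : Kq) (n : ℤ) :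
    qbr μ (n - 1) - q⁻¹ * qbr μ n = -(q ^ (-n) * μ⁻¹) := by
  have h0 := q_sub_inv_ne_zero
  have hq := q_ne_zero
  rw [qbr, qbr, ← mul_div_assoc, ← sub_div, div_eq_iff h0]
  simp only [neg_add, sub_eq_add_neg, neg_neg, zpow_add₀ hq, zpow_neg, zpow_one]
  ring

theorem zetaMinus_sub_zetaPlus (κ : ℤ) {μ : Kq} (hμ : μ ≠ 0) (i j : ℤ) :
    zetaMinus κ μ i - zetaPlus κ μ j = qint (κ - i - j) * qpl μ (j - i) := by
  have h0 := q_sq_sub_one_ne_zero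
  have hq := q_ne_zero
  have h1 := zpow_ne_zero i q_ne_zero
  have h2 := zpow_ne_zero j q_ne_zero
  have h3 := zpow_ne_zero κ q_ne_zero
  simp only [zetaPlus, zetaMinus, qint, qpl, neg_add,
    sub_eq_add_neg, neg_neg, zpow_add₀ hq, zpow_neg]
  generalize q ^ i = x at *
  generalize q ^ j = y at *
  generalize q ^ κ = k at *
  rw [q_add_neg_inv]
  field_simp
  ring

/-- The parameters of a good Verma module. -/
structure GoodWeight where
  κd : ℤ
  κ1 : ℤ
  μ : Kq
  ζ : Kq
  hμ : μ ≠ 0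
  good : IsGood μ

/-! ### The representation on the lattice. -/

namespace GoodWeight

variable (P : GoodWeight)

/-- `{n} = q^n μ + q^{-n} μ⁻¹` -/
def br (n : ℤ) : Kq := qpl P.μ n

theorem br_ne_zero (n : ℤ) : P.br n ≠ 0 := qpl_ne_zero P.hμ P.good n

def κ : ℤ := P.κd - P.κ1

def cPlus (a b : ℤ) : Kq := coeffPlus P.κ P.μ P.ζ a / P.br (a - b)

def cMinus (a b : ℤ) : Kq := coeffMinus P.κ P.μ P.ζ b / P.br (a - b)

/-- The space with basis indexed by `ℤ × ℤ` on which `U_q'` acts. -/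
abbrev Lattice : Type := (ℤ × ℤ) →₀ Kq

/-- The basis vectors. -/
def W (a b : ℤ) : Lattice := Finsupp.single (a, b) 1

/-- The linear map with prescribed values on basis vectors. -/
def extend (f : ℤ → ℤ → Lattice) : Module.End Kq Lattice :=
  Finsupp.linearCombination Kq fun p : ℤ × ℤ => f p.1 p.2

@[simp]
theorem extend_W (f : ℤ → ℤ → Lattice) (a b : ℤ) : extend f (W a b) = f a b := by
  simp [extend, W]

theorem ext_W {f g : Module.End Kq Lattice} (h : ∀ a b, f (W a b) = g (W a b)) : f = g := by
  refine Finsupp.lhom_ext' fun p => LinearMap.ext_ring ?_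
  exact h p.1 p.2

/-- The action of the generators of `U_q'`. -/
def op : Gen → Module.End Kq Lattice
  | .b0 => extend fun a b => qbr P.μ (a - b) • W a b
  | .b1 => extend fun a b => P.cPlus a b • W (a - 1) b + P.cMinus a b • W a (b - 1)
  | .bm1 => extend fun a b => (P.br (a - b))⁻¹ • (W (a + 1) b + W a (b + 1))
  | .dd => extend fun a b => q ^ (P.κd - a - b) • W a b
  | .ddInv => extend fun a b => q ^ (-(P.κd - a - b)) • W a b
  | .d1 => extend fun a b => q ^ (P.κ1 + a + b) • W a b
  | .d1Inv => extend fun a b => q ^ (-(P.κ1 + a + b)) • W a b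

theorem op_b0 (a b : ℤ) : P.op .b0 (W a b) = qbr P.μ (a - b) • W a b := by
  rw [op, extend_W]
theorem op_b1 (a b : ℤ) :
    P.op .b1 (W a b) = P.cPlus a b • W (a - 1) b + P.cMinus a b • W a (b - 1) := by
  rw [op, extend_W]
theorem op_bm1 (a b : ℤ) :
    P.op .bm1 (W a b) = (P.br (a - b))⁻¹ • (W (a + 1) b + W a (b + 1)) := by
  rw [op, extend_W]
theorem op_dd (a b : ℤ) : P.op .dd (W a b) = q ^ (P.κd - a - b) • W a b := by
  rw [op, extend_W]
theorem op_ddInv (a b : ℤ) :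
    P.op .ddInv (W a b) = q ^ (-(P.κd - a - b)) • W a b := by
  rw [op, extend_W]
theorem op_d1 (a b : ℤ) : P.op .d1 (W a b) = q ^ (P.κ1 + a + b) • W a b := by
  rw [op, extend_W]
theorem op_d1Inv (a b : ℤ) :
    P.op .d1Inv (W a b) = q ^ (-(P.κ1 + a + b)) • W a b := by
  rw [op, extend_W]

/-- The operators satisfy the commutation relation of `B_1` and `B_{-1}`. -/
theorem op_b1_bm1 :
    P.op .b1 * P.op .bm1 - P.op .bm1 * P.op .b1 =
      (q - q⁻¹)⁻¹ • (P.op .dd * P.op .d1Inv - P.op .d1 * P.op .ddInv) := by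
  refine ext_W fun a b => ?_
  have h1 := P.br_ne_zero (a - b)
  have h2 := P.br_ne_zero (a - b + 1)
  have h3 := P.br_ne_zero (a - b - 1)
  have hid := coeff_identity P.κ P.hμ P.ζ a b
  have e1 : a + 1 - b = a - b + 1 := by ring
  have e2 : a - (b + 1) = a - b - 1 := by ring
  have e3 : a - 1 - b = a - b - 1 := by ring
  have e4 : a - (b - 1) = a - b + 1 := by ring
  have hk : (q - q⁻¹)⁻¹ * (q ^ (-(P.κ1 + a + b)) * q ^ (P.κd - a - b)
      - q ^ (-(P.κd - a - b)) * q ^ (P.κ1 + a + b)) = qint (P.κ - 2 * (a + b)) := by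
    rw [← zpow_add₀ q_ne_zero, ← zpow_add₀ q_ne_zero, qint, div_eq_inv_mul, κ]
    have h1 : -(P.κ1 + a + b) + (P.κd - a - b) = P.κd - P.κ1 - 2 * (a + b) := by ring
    have h2 : -(P.κd - a - b) + (P.κ1 + a + b) = -(P.κd - P.κ1 - 2 * (a + b)) := by ring
    rw [h1, h2]
  simp only [LinearMap.sub_apply, LinearMap.smul_apply, Module.End.mul_apply, op_b1, op_bm1,
    op_dd, op_d1, op_ddInv, op_d1Inv, map_smul, map_add, add_sub_cancel_right, sub_add_cancel,
    smul_add, smul_smul, ← sub_smul, hk]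
  rw [← sub_eq_zero]
  simp only [cPlus, cMinus, e1, e2, e3, e4]
  change qpl P.μ (a - b) ≠ 0 at h1
  change qpl P.μ (a - b + 1) ≠ 0 at h2
  change qpl P.μ (a - b - 1) ≠ 0 at h3
  simp only [br]
  match_scalars
  · field_simp
    linear_combination hid
  · field_simp
    ring
  · field_simp
    ring

theorem op_serre_b0_b1 :
    P.op .b0 * P.op .b0 * P.op .b1 - qint 2 • (P.op .b0 * P.op .b1 * P.op .b0)
      + P.op .b1 * P.op .b0 * P.op .b0 = P.op .b1 := by
  refine ext_W fun a b => ?_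
  have h1 := qbr_add_one_add P.μ (a - b)
  have h2 := qbr_mul P.hμ (a - b)
  have e3 : a - 1 - b = a - b - 1 := by ring
  have e4 : a - (b - 1) = a - b + 1 := by ring
  simp only [LinearMap.sub_apply, LinearMap.add_apply, LinearMap.smul_apply,
    Module.End.mul_apply, op_b1, op_b0, map_smul, map_add, e3, e4]
  match_scalars
  · linear_combination P.cPlus a b * (qbr P.μ (a - b - 1) * h1 - h2)
  · linear_combination P.cMinus a b * (qbr P.μ (a - b + 1) * h1 - h2)

theorem op_serre_b0_bm1 :
    P.op .b0 * P.op .b0 * P.op .bm1 - qint 2 • (P.op .b0 * P.op .bm1 * P.op .b0)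
      + P.op .bm1 * P.op .b0 * P.op .b0 = P.op .bm1 := by
  refine ext_W fun a b => ?_
  have h1 := qbr_add_one_add P.μ (a - b)
  have h2 := qbr_mul P.hμ (a - b)
  have e1 : a + 1 - b = a - b + 1 := by ring
  have e2 : a - (b + 1) = a - b - 1 := by ring
  simp only [LinearMap.sub_apply, LinearMap.add_apply, LinearMap.smul_apply,
    Module.End.mul_apply, op_bm1, op_b0, map_smul, map_add, e1, e2]
  match_scalars
  · linear_combination (P.br (a - b))⁻¹ * (qbr P.μ (a - b + 1) * h1 - h2)
  · linear_combination (P.br (a - b))⁻¹ * (qbr P.μ (a - b - 1) * h1 - h2)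

/-- The delicate component is `W (a-1) (b-1)`, reached by two paths. With `n = a - b`, the path
through `W (a-1) b` has denominator `{n-1}`, cancelled by `2[μ;n] - [2][μ;n-1] = {n-1}`. The other
path gives the opposite value in the same way. -/
theorem op_serre_b1_b0 :
    P.op .b1 * P.op .b1 * P.op .b0 - qint 2 • (P.op .b1 * P.op .b0 * P.op .b1)
      + P.op .b0 * P.op .b1 * P.op .b1 = 0 := by
  refine ext_W fun a b => ?_
  have h1 := qbr_add_one_add P.μ (a - b - 1)
  have h2 := qbr_add_one_add P.μ (a - b + 1)
  have h3 := two_qbr_sub P.μ (a - b)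
  have h4 := two_qbr_sub' P.μ (a - b)
  have e3 : a - 1 - b = a - b - 1 := by ring
  have e4 : a - (b - 1) = a - b + 1 := by ring
  have e5 : a - 1 - 1 - b = a - b - 1 - 1 := by ring
  have e6 : a - (b - 1 - 1) = a - b + 1 + 1 := by ring
  have e7 : a - 1 - (b - 1) = a - b := by ring
  simp only [add_sub_cancel_right, sub_add_cancel] at h1 h2
  have g1 := P.br_ne_zero (a - b)
  have g2 := P.br_ne_zero (a - b + 1)
  have g3 := P.br_ne_zero (a - b - 1)
  change P.op .b1 (P.op .b1 (P.op .b0 (W a b))) - qint 2 • P.op .b1 (P.op .b0 (P.op .b1 (W a b)))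
    + P.op .b0 (P.op .b1 (P.op .b1 (W a b))) = 0
  simp only [op_b1, op_b0, map_smul, map_add, e3, e4, e5, e6, e7, cPlus, cMinus]
  change _ = -P.br (a - b + 1) at h3
  change _ = P.br (a - b - 1) at h4
  match_scalars
  · linear_combination coeffPlus P.κ P.μ P.ζ a / P.br (a - b) *
      (coeffPlus P.κ P.μ P.ζ (a - 1) / P.br (a - b - 1)) * h1
  · field_simp
    linear_combination coeffPlus P.κ P.μ P.ζ a * coeffMinus P.κ P.μ P.ζ b *
      (P.br (a - b + 1) * h4 + P.br (a - b - 1) * h3)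
  · linear_combination coeffMinus P.κ P.μ P.ζ b / P.br (a - b) *
      (coeffMinus P.κ P.μ P.ζ (b - 1) / P.br (a - b + 1)) * h2

theorem op_serre_bm1_b0 :
    P.op .bm1 * P.op .bm1 * P.op .b0 - qint 2 • (P.op .bm1 * P.op .b0 * P.op .bm1)
      + P.op .b0 * P.op .bm1 * P.op .bm1 = 0 := by
  refine ext_W fun a b => ?_
  have h1 := qbr_add_one_add P.μ (a - b - 1)
  have h2 := qbr_add_one_add P.μ (a - b + 1)
  have h3 := two_qbr_sub P.μ (a - b)
  have h4 := two_qbr_sub' P.μ (a - b)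
  have e1 : a + 1 - b = a - b + 1 := by ring
  have e2 : a - (b + 1) = a - b - 1 := by ring
  have e5 : a + 1 + 1 - b = a - b + 1 + 1 := by ring
  have e6 : a - (b + 1 + 1) = a - b - 1 - 1 := by ring
  have e7 : a + 1 - (b + 1) = a - b := by ring
  simp only [add_sub_cancel_right, sub_add_cancel] at h1 h2
  have g1 := P.br_ne_zero (a - b)
  have g2 := P.br_ne_zero (a - b + 1)
  have g3 := P.br_ne_zero (a - b - 1)
  change P.op .bm1 (P.op .bm1 (P.op .b0 (W a b)))
    - qint 2 • P.op .bm1 (P.op .b0 (P.op .bm1 (W a b)))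
    + P.op .b0 (P.op .bm1 (P.op .bm1 (W a b))) = 0
  simp only [op_bm1, op_b0, map_smul, map_add, e1, e2, e5, e6, e7]
  change _ = -P.br (a - b + 1) at h3
  change _ = P.br (a - b - 1) at h4
  match_scalars
  · linear_combination (P.br (a - b))⁻¹ * (P.br (a - b + 1))⁻¹ * h2
  · field_simp
    linear_combination P.br (a - b + 1) * h4 + P.br (a - b - 1) * h3
  · linear_combination (P.br (a - b))⁻¹ * (P.br (a - b - 1))⁻¹ * h1

/-- The representation of the free algebra. -/
def freeRep : Free →ₐ[Kq] Module.End Kq Lattice := FreeAlgebra.lift Kq P.op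

theorem freeRep_gen (g : Gen) : P.freeRep (gen g) = P.op g := FreeAlgebra.lift_ι_apply _ _

theorem freeRep_rel {x y : Free} (h : Rel x y) : P.freeRep x = P.freeRep y := by
  have hq := q_ne_zero
  cases h <;> simp only [map_mul, map_add, map_sub, map_smul, map_one, map_zero, freeRep_gen]
  case b1_bm1 => exact P.op_b1_bm1
  case serre_b0_b1 => exact P.op_serre_b0_b1
  case serre_b0_bm1 => exact P.op_serre_b0_bm1
  case serre_b1_b0 => exact P.op_serre_b1_b0
  case serre_bm1_b0 => exact P.op_serre_bm1_b0
  all_goals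
    refine ext_W fun a b => ?_
    simp only [LinearMap.smul_apply, Module.End.mul_apply, Module.End.one_apply, op_b1, op_bm1,
      op_dd, op_d1, op_ddInv, op_d1Inv, op_b0, map_smul, map_add, smul_add]
    have e1 : P.κd - (a - 1) - b = P.κd - a - b + 1 := by ring
    have e2 : P.κd - a - (b - 1) = P.κd - a - b + 1 := by ring
    have e3 : P.κd - (a + 1) - b = P.κd - a - b - 1 := by ring
    have e4 : P.κd - a - (b + 1) = P.κd - a - b - 1 := by ring
    have e5 : P.κ1 + (a - 1) + b = P.κ1 + a + b - 1 := by ring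
    have e6 : P.κ1 + a + (b - 1) = P.κ1 + a + b - 1 := by ring
    have e7 : P.κ1 + (a + 1) + b = P.κ1 + a + b + 1 := by ring
    have e8 : P.κ1 + a + (b + 1) = P.κ1 + a + b + 1 := by ring
    have h1 := zpow_ne_zero (P.κd - a - b) hq
    have h2 := zpow_ne_zero (P.κ1 + a + b) hq
    try simp only [e1, e2, e3, e4, e5, e6, e7, e8, zpow_add_one₀ hq, zpow_sub_one₀ hq, zpow_neg]
    match_scalars <;> field_simp

/-- The representation of `U_q'` on the lattice. -/
def rep : Uq' →ₐ[Kq] Module.End Kq Lattice :=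
  RingQuot.liftAlgHom Kq ⟨P.freeRep, fun _ _ h => P.freeRep_rel h⟩

theorem rep_u (g : Gen) : P.rep (u g) = P.op g := by
  rw [rep, u, RingQuot.liftAlgHom_mkAlgHom_apply, freeRep_gen]

/-- Since `W a b` is a `B_0`-eigenvector, both terms of `X` vanish as soon as `B_1` kills it; `X`
imposes no further condition. -/
theorem rep_X_W (a b : ℤ) (hp : P.cPlus a b = 0) (hm : P.cMinus a b = 0) :
    P.rep X (W a b) = 0 := by
  have h0 : P.op .b1 (W a b) = 0 := by rw [op_b1, hp, hm]; simp
  simp only [X, qcomm, map_sub, map_smul, map_mul, LinearMap.sub_apply, LinearMap.smul_apply,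
    Module.End.mul_apply, B0, B1, rep_u, op_b0, h0, map_zero, smul_zero, sub_zero]

theorem rep_Y_W (a b : ℤ) :
    P.rep Y (W a b) = (q ^ (a - b) * P.μ / P.br (a - b)) • W (a + 1) b
      - (q ^ (-(a - b)) * P.μ⁻¹ / P.br (a - b)) • W a (b + 1) := by
  have h1 := qbr_add_one_sub_qinv_mul P.μ (a - b)
  have h2 := qbr_sub_one_sub_qinv_mul P.μ (a - b)
  have e1 : a + 1 - b = a - b + 1 := by ring
  have e2 : a - (b + 1) = a - b - 1 := by ring
  simp only [Y, qcomm, map_sub, map_smul, map_mul, LinearMap.sub_apply, LinearMap.smul_apply,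
    Module.End.mul_apply, B0, Bm1, rep_u, op_b0, op_bm1, map_add, e1, e2]
  match_scalars
  · linear_combination (P.br (a - b))⁻¹ * h1
  · linear_combination (P.br (a - b))⁻¹ * h2

/-- The eigenvalue of `Z` on a vector `W a b` killed by `B_1`. -/
def zEigen (a b : ℤ) : Kq :=
  (q ^ (a - b) * P.μ * coeffPlus P.κ P.μ P.ζ (a + 1) / P.br (a - b + 1)
    - q ^ (-(a - b)) * P.μ⁻¹ * coeffMinus P.κ P.μ P.ζ (b + 1) / P.br (a - b - 1)) / P.br (a - b)

theorem rep_Z_W (a b : ℤ) (hp : P.cPlus a b = 0) (hm : P.cMinus a b = 0) :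
    P.rep Z (W a b) = P.zEigen a b • W a b := by
  have h0 : P.op .b1 (W a b) = 0 := by rw [op_b1, hp, hm]; simp
  have e1 : a + 1 - b = a - b + 1 := by ring
  have e2 : a - (b + 1) = a - b - 1 := by ring
  have hp' : coeffPlus P.κ P.μ P.ζ a = 0 := by simpa [cPlus, P.br_ne_zero] using hp
  have hm' : coeffMinus P.κ P.μ P.ζ b = 0 := by simpa [cMinus, P.br_ne_zero] using hm
  rw [Z, qcomm, map_sub, map_smul, map_mul, map_mul, LinearMap.sub_apply, LinearMap.smul_apply,
    Module.End.mul_apply, Module.End.mul_apply, B1, rep_u, h0, map_zero, smul_zero, sub_zero,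
    rep_Y_W, map_sub, map_smul, map_smul, op_b1, op_b1]
  simp only [cPlus, cMinus, e1, e2, add_sub_cancel_right, hp', hm', zero_div, zero_smul, add_zero,
    zero_add]
  rw [smul_smul, smul_smul, ← sub_smul, zEigen]
  congr 1
  ring

end GoodWeight

/-! ### Consequences of the relations in an arbitrary representation. -/

theorem u_rel {x y : Free} (h : Rel x y) :
    RingQuot.mkAlgHom Kq Rel x = RingQuot.mkAlgHom Kq Rel y := RingQuot.mkAlgHom_rel Kq h

section Relations

variable {V : Type*} [AddCommGroup V] [Module Kq V] (σ : Uq' →ₐ[Kq] Module.End Kq V) (x : V)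

theorem act_ddInv_dd : σ (u .ddInv) (σ Dd x) = x := by
  have h := congrArg (fun z => σ z x) (u_rel Rel.inv_dd)
  simp only [map_mul, map_one] at h
  exact h

theorem act_d1Inv_d1 : σ (u .d1Inv) (σ D1 x) = x := by
  have h := congrArg (fun z => σ z x) (u_rel Rel.inv_d1)
  simp only [map_mul, map_one] at h
  exact h

theorem act_dd_bm1 : σ Dd (σ Bm1 x) = q⁻¹ • σ Bm1 (σ Dd x) := by
  have h := congrArg (fun z => σ z x) (u_rel Rel.dd_bm1)
  simp only [map_mul, map_smul] at h
  exact h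

theorem act_d1_bm1 : σ D1 (σ Bm1 x) = q • σ Bm1 (σ D1 x) := by
  have h := congrArg (fun z => σ z x) (u_rel Rel.d1_bm1)
  simp only [map_mul, map_smul] at h
  exact h

theorem act_dd_b0 : σ Dd (σ B0 x) = σ B0 (σ Dd x) := by
  have h := congrArg (fun z => σ z x) (u_rel Rel.dd_b0)
  simp only [map_mul] at h
  exact h

theorem act_d1_b0 : σ D1 (σ B0 x) = σ B0 (σ D1 x) := by
  have h := congrArg (fun z => σ z x) (u_rel Rel.d1_b0)
  simp only [map_mul] at h
  exact h

theorem act_b1_bm1 : σ B1 (σ Bm1 x) = σ Bm1 (σ B1 x) +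
    (q - q⁻¹)⁻¹ • (σ Dd (σ (u .d1Inv) x) - σ D1 (σ (u .ddInv) x)) := by
  have h := congrArg (fun z => σ z x) (u_rel Rel.b1_bm1)
  simp only [map_mul, map_smul, map_sub] at h
  exact sub_eq_iff_eq_add'.mp h

theorem act_serre_b0_b1 :
    σ B0 (σ B0 (σ B1 x)) - qint 2 • σ B0 (σ B1 (σ B0 x)) + σ B1 (σ B0 (σ B0 x)) = σ B1 x := by
  have h := congrArg (fun z => σ z x) (u_rel Rel.serre_b0_b1)
  simp only [map_mul, map_smul, map_sub, map_add] at h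
  exact h

theorem act_serre_b0_bm1 :
    σ B0 (σ B0 (σ Bm1 x)) - qint 2 • σ B0 (σ Bm1 (σ B0 x)) + σ Bm1 (σ B0 (σ B0 x)) = σ Bm1 x := by
  have h := congrArg (fun z => σ z x) (u_rel Rel.serre_b0_bm1)
  simp only [map_mul, map_smul, map_sub, map_add] at h
  exact h

theorem act_serre_bm1_b0 :
    σ Bm1 (σ Bm1 (σ B0 x)) - qint 2 • σ Bm1 (σ B0 (σ Bm1 x)) + σ B0 (σ Bm1 (σ Bm1 x)) = 0 := by
  have h := congrArg (fun z => σ z x) (u_rel Rel.serre_bm1_b0)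
  simp only [map_mul, map_smul, map_sub, map_add, map_zero] at h
  exact h

theorem act_Y : σ Y x = σ B0 (σ Bm1 x) - q⁻¹ • σ Bm1 (σ B0 x) := by
  rw [Y, qcomm, map_sub, map_smul, map_mul, map_mul]
  rfl

theorem act_Z : σ Z x = σ B1 (σ Y x) - q⁻¹ • σ Y (σ B1 x) := by
  rw [Z, qcomm, map_sub, map_smul, map_mul, map_mul]
  rfl

variable {σ x}

/-- A subspace closed under the generators is closed under `U_q'`. -/
theorem act_mem {S : Submodule Kq V} (h : ∀ g, ∀ y ∈ S, σ (u g) y ∈ S) (a : Uq') :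
    ∀ y ∈ S, σ a y ∈ S := by
  obtain ⟨a, rfl⟩ := RingQuot.mkAlgHom_surjective Kq Rel a
  induction a using FreeAlgebra.induction with
  | grade0 r =>
    intro y hy
    rw [AlgHom.commutes, AlgHom.commutes]
    exact S.smul_mem r hy
  | grade1 g => exact h g
  | mul a b ha hb =>
    intro y hy
    rw [map_mul, map_mul]
    exact ha _ (hb y hy)
  | add a b ha hb =>
    intro y hy
    rw [map_add, map_add]
    exact S.add_mem (ha y hy) (hb y hy)

variable {μ : Kq} {n : ℤ}

/-- The Serre relation at an eigenvector factors as `(B_0 - [μ;n+1])(B_0 - [μ;n-1]) B_{-1} x = 0`.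
-/
theorem quadratic_bm1 (hμ : μ ≠ 0) (hx : σ B0 x = qbr μ n • x) :
    σ B0 (σ B0 (σ Bm1 x)) = (qbr μ (n + 1) + qbr μ (n - 1)) • σ B0 (σ Bm1 x)
      - (qbr μ (n + 1) * qbr μ (n - 1)) • σ Bm1 x := by
  have h := act_serre_b0_bm1 σ x
  rw [hx, map_smul, map_smul, map_smul, hx, map_smul, map_smul] at h
  rw [qbr_add_one_add, qbr_mul hμ]
  generalize σ B0 (σ B0 (σ Bm1 x)) = y1 at *
  generalize σ B0 (σ Bm1 x) = y2 at *
  generalize σ Bm1 x = y3 at *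
  linear_combination (norm := module) h

theorem quadratic_b1 (hμ : μ ≠ 0) (hx : σ B0 x = qbr μ n • x) :
    σ B0 (σ B0 (σ B1 x)) = (qbr μ (n + 1) + qbr μ (n - 1)) • σ B0 (σ B1 x)
      - (qbr μ (n + 1) * qbr μ (n - 1)) • σ B1 x := by
  have h := act_serre_b0_b1 σ x
  rw [hx, map_smul, map_smul, map_smul, hx, map_smul, map_smul] at h
  rw [qbr_add_one_add, qbr_mul hμ]
  generalize σ B0 (σ B0 (σ B1 x)) = y1 at *
  generalize σ B0 (σ B1 x) = y2 at *
  generalize σ B1 x = y3 at *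
  linear_combination (norm := module) h

theorem qbr_mul_sub (n : ℤ) :
    qbr μ (n + 2) * qbr μ (n - 1) - qbr μ (n - 2) * qbr μ (n + 1) = qpl μ n * qbr μ n := by
  have h1 := qbr_add_one_add μ (n + 1)
  have h2 := qbr_add_one_add μ (n - 1)
  have h3 := qbr_add_one_sub μ n
  have e1 : n + 1 + 1 = n + 2 := by ring
  have e2 : n - 1 - 1 = n - 2 := by ring
  rw [add_sub_cancel_right, e1] at h1
  rw [sub_add_cancel, e2] at h2
  linear_combination qbr μ (n - 1) * h1 - qbr μ (n + 1) * h2 + qbr μ n * h3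

theorem qbr_two_sub (n : ℤ) :
    qbr μ (n + 2) - qbr μ (n - 2) = qint 2 * qpl μ n := by
  have h1 := qbr_add_one_add μ (n + 1)
  have h2 := qbr_add_one_add μ (n - 1)
  have h3 := qbr_add_one_sub μ n
  have e1 : n + 1 + 1 = n + 2 := by ring
  have e2 : n - 1 - 1 = n - 2 := by ring
  rw [add_sub_cancel_right, e1] at h1
  rw [sub_add_cancel, e2] at h2
  linear_combination h1 - h2 + qint 2 * h3

/-- The two ways of applying the raising and the lowering part of `B_{-1}` agree. -/
theorem bm1_parts_comm (hx : σ B0 x = qbr μ n • x) :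
    σ B0 (σ Bm1 (qbr μ (n + 1) • σ Bm1 x - σ B0 (σ Bm1 x)))
      - qbr μ (n - 2) • σ Bm1 (qbr μ (n + 1) • σ Bm1 x - σ B0 (σ Bm1 x)) =
    qbr μ (n + 2) • σ Bm1 (σ B0 (σ Bm1 x) - qbr μ (n - 1) • σ Bm1 x)
      - σ B0 (σ Bm1 (σ B0 (σ Bm1 x) - qbr μ (n - 1) • σ Bm1 x)) := by
  have h := act_serre_bm1_b0 σ x
  have h1 := qbr_mul_sub (μ := μ) n
  have h2 := qbr_add_one_sub μ n
  have h3 := qbr_two_sub (μ := μ) n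
  rw [hx, map_smul, map_smul] at h
  simp only [map_sub, map_smul]
  generalize σ B0 (σ Bm1 (σ Bm1 x)) = y1 at *
  generalize σ Bm1 (σ B0 (σ Bm1 x)) = y2 at *
  generalize σ Bm1 (σ Bm1 x) = y3 at *
  generalize σ B0 (σ Bm1 (σ B0 (σ Bm1 x))) = y4 at *
  -- The difference of the two sides is exactly `{n}` times the Serre relation at `x`.
  have h' : qpl μ n • (qbr μ n • y3 - qint 2 • y2 + y1) = 0 := by rw [h, smul_zero]
  rw [← sub_eq_zero, ← h']
  match_scalars
  · linear_combination h2
  · ring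
  · linear_combination h1
  · linear_combination -h3

end Relations

/-! ### Spanning vectors in a highest weight representation. -/

namespace GoodWeight

variable (P : GoodWeight) {V : Type*} [AddCommGroup V] [Module Kq V]

/-- The vectors obtained from `v` by applying the raising and the lowering part of `B_{-1}`. -/
def vec (σ : Uq' →ₐ[Kq] Module.End Kq V) (v : V) : ℕ → ℕ → V
  | 0, 0 => v
  | 0, b + 1 => qbr P.μ (0 - b + 1) • σ Bm1 (vec σ v 0 b) - σ B0 (σ Bm1 (vec σ v 0 b))
  | a + 1, b => σ B0 (σ Bm1 (vec σ v a b)) - qbr P.μ (a - b - 1) • σ Bm1 (vec σ v a b)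

/-- The vector `v` satisfies the defining relations of the highest weight vector. -/
structure IsHighest (σ : Uq' →ₐ[Kq] Module.End Kq V) (v : V) : Prop where
  b1 : σ B1 v = 0
  dd : σ Dd v = q ^ P.κd • v
  d1 : σ D1 v = q ^ P.κ1 • v
  b0 : σ B0 v = qbr P.μ 0 • v
  z : σ Z v = P.ζ • v

theorem coeffPlus_zero (κ : ℤ) (μ ζ : Kq) : coeffPlus κ μ ζ 0 = 0 := by
  simp [coeffPlus, qint_zero]

theorem coeffMinus_zero (κ : ℤ) (μ ζ : Kq) : coeffMinus κ μ ζ 0 = 0 := by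
  simp [coeffMinus, qint_zero]

theorem cPlus_zero (b : ℤ) : P.cPlus 0 b = 0 := by
  rw [cPlus, coeffPlus_zero, zero_div]

theorem cMinus_zero (a : ℤ) : P.cMinus a 0 = 0 := by
  rw [cMinus, coeffMinus_zero, zero_div]

/-- Confirms that the parameter `ζ` in the coefficients of `B_1` is the eigenvalue of `Z` at the
origin of the lattice. -/
theorem zEigen_zero : P.zEigen 0 0 = P.ζ := by
  have h0 := P.br_ne_zero 0
  have h1 := P.br_ne_zero 1
  have h2 := P.br_ne_zero (-1)
  simp only [zEigen, coeffPlus, coeffMinus, zetaPlus, zetaMinus, zero_add, sub_self, qint_one,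
    zero_sub, neg_zero, zpow_zero, qint_zero, sub_zero, one_mul, mul_zero, mul_one]
  rw [← br, ← br]
  have e : P.br 0 = P.μ + P.μ⁻¹ := by simp [br, qpl]
  have hμ := P.hμ
  have e' : P.μ + P.μ⁻¹ = (P.μ ^ 2 + 1) / P.μ := by field_simp
  have h3 : P.μ ^ 2 + 1 ≠ 0 := fun h => h0 (by rw [e, e', h, zero_div])
  rw [e, e']
  field_simp
  ring

theorem cPlus_add (a b : ℤ) : P.cPlus (a + 1) b + P.cMinus a (b + 1) =
    P.br (a - b) * (qint (P.κ - 2 * (a + b)) + P.cPlus a b * (P.br (a - b - 1))⁻¹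
      + P.cMinus a b * (P.br (a - b + 1))⁻¹) := by
  have h1 := P.br_ne_zero (a - b)
  have h2 := P.br_ne_zero (a - b + 1)
  have h3 := P.br_ne_zero (a - b - 1)
  have hid := coeff_identity P.κ P.hμ P.ζ a b
  have e1 : a + 1 - b = a - b + 1 := by ring
  have e2 : a - (b + 1) = a - b - 1 := by ring
  simp only [cPlus, cMinus, e1, e2]
  change (_ - _) * P.br (a - b - 1) + (_ - _) * P.br (a - b + 1) = _ * P.br (a - b) *
    P.br (a - b + 1) * P.br (a - b - 1) at hid
  field_simp
  linear_combination hid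

theorem cPlus_succ (a b : ℤ) :
    P.cPlus a (b + 1) = P.br (a - b) * (P.cPlus a b * (P.br (a - b - 1))⁻¹) := by
  have h1 := P.br_ne_zero (a - b)
  have e2 : a - (b + 1) = a - b - 1 := by ring
  simp only [cPlus, e2]
  field_simp

theorem cMinus_succ (a b : ℤ) :
    P.cMinus (a + 1) b = P.br (a - b) * (P.cMinus a b * (P.br (a - b + 1))⁻¹) := by
  have h1 := P.br_ne_zero (a - b)
  have e1 : a + 1 - b = a - b + 1 := by ring
  simp only [cMinus, e1]
  field_simp

/-- The defect of the expected formula for `B_1` on `vec a b`. -/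
def defect (σ : Uq' →ₐ[Kq] Module.End Kq V) (v : V) (a b : ℕ) : V :=
  σ B1 (P.vec σ v a b) -
    (P.cPlus a b • P.vec σ v (a - 1) b + P.cMinus a b • P.vec σ v a (b - 1))

variable {P} {σ : Uq' →ₐ[Kq] Module.End Kq V} {v : V}

theorem vec_succ_left (a b : ℕ) : P.vec σ v (a + 1) b =
    σ B0 (σ Bm1 (P.vec σ v a b)) - qbr P.μ (a - b - 1) • σ Bm1 (P.vec σ v a b) := by
  rw [vec]

namespace IsHighest

variable (h : P.IsHighest σ v)
include h

theorem b0_vec (a b : ℕ) : σ B0 (P.vec σ v a b) = qbr P.μ (a - b) • P.vec σ v a b := by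
  induction a with
  | zero =>
    induction b with
    | zero => simpa [vec] using h.b0
    | succ b ih =>
      have hq := quadratic_bm1 P.hμ ih
      have e : ((0 : ℕ) : ℤ) - ((b + 1 : ℕ) : ℤ) = (0 : ℤ) - b - 1 := by push_cast; ring
      rw [e, vec, map_sub, map_smul]
      rw [Nat.cast_zero] at hq
      rw [hq]
      module
  | succ a ih =>
    have hq := quadratic_bm1 P.hμ ih
    have e : ((a + 1 : ℕ) : ℤ) - b = (a : ℤ) - b + 1 := by push_cast; ring
    rw [e, vec, map_sub, map_smul, hq]
    module

/-- The recursion for `vec` lowers only in the column `a = 0`; `bm1_parts_comm` carries lowering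
past each raising step. -/
theorem vec_succ_right (a b : ℕ) : P.vec σ v a (b + 1) =
    qbr P.μ (a - b + 1) • σ Bm1 (P.vec σ v a b) - σ B0 (σ Bm1 (P.vec σ v a b)) := by
  induction a with
  | zero => rw [vec, Nat.cast_zero]
  | succ a ih =>
    have hc := bm1_parts_comm (h.b0_vec a b)
    have e1 : (a : ℤ) - ((b + 1 : ℕ) : ℤ) - 1 = (a : ℤ) - b - 2 := by push_cast; ring
    have e2 : ((a + 1 : ℕ) : ℤ) - b + 1 = (a : ℤ) - b + 2 := by push_cast; ring
    rw [vec_succ_left, ih, e1, e2, vec_succ_left]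
    exact hc

theorem bm1_vec (a b : ℕ) : σ Bm1 (P.vec σ v a b) =
    (P.br (a - b))⁻¹ • (P.vec σ v (a + 1) b + P.vec σ v a (b + 1)) := by
  have h1 := qbr_add_one_sub P.μ (a - b)
  have h2 : P.br (a - b) ≠ 0 := P.br_ne_zero _
  rw [eq_inv_smul_iff₀ h2, vec_succ_left, h.vec_succ_right, br, ← h1]
  module

theorem dd_vec (a b : ℕ) : σ Dd (P.vec σ v a b) = q ^ (P.κd - a - b) • P.vec σ v a b := by
  have hq := q_ne_zero
  induction a with
  | zero =>
    induction b with
    | zero => simpa [vec] using h.dd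
    | succ b ih =>
      have e : P.κd - (0 : ℕ) - (b + 1 : ℕ) = P.κd - (0 : ℕ) - b - 1 := by push_cast; ring
      rw [e, vec, map_sub, map_smul, act_dd_b0, act_dd_bm1, ih, zpow_sub_one₀ hq]
      simp only [map_smul]
      module
  | succ a ih =>
    have e : P.κd - (a + 1 : ℕ) - b = P.κd - a - b - 1 := by push_cast; ring
    rw [e, vec, map_sub, map_smul, act_dd_b0, act_dd_bm1, ih, zpow_sub_one₀ hq]
    simp only [map_smul]
    module

theorem d1_vec (a b : ℕ) : σ D1 (P.vec σ v a b) = q ^ (P.κ1 + a + b) • P.vec σ v a b := by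
  have hq := q_ne_zero
  induction a with
  | zero =>
    induction b with
    | zero => simpa [vec] using h.d1
    | succ b ih =>
      have e : P.κ1 + (0 : ℕ) + (b + 1 : ℕ) = P.κ1 + (0 : ℕ) + b + 1 := by push_cast; ring
      rw [e, vec, map_sub, map_smul, act_d1_b0, act_d1_bm1, ih, zpow_add_one₀ hq]
      simp only [map_smul]
      module
  | succ a ih =>
    have e : P.κ1 + (a + 1 : ℕ) + b = P.κ1 + a + b + 1 := by push_cast; ring
    rw [e, vec, map_sub, map_smul, act_d1_b0, act_d1_bm1, ih, zpow_add_one₀ hq]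
    simp only [map_smul]
    module

theorem ddInv_vec (a b : ℕ) :
    σ (u .ddInv) (P.vec σ v a b) = q ^ (-(P.κd - a - b)) • P.vec σ v a b := by
  have h1 := act_ddInv_dd σ (P.vec σ v a b)
  rw [h.dd_vec, map_smul] at h1
  rw [zpow_neg, eq_inv_smul_iff₀ (zpow_ne_zero _ q_ne_zero), h1]

theorem d1Inv_vec (a b : ℕ) :
    σ (u .d1Inv) (P.vec σ v a b) = q ^ (-(P.κ1 + a + b)) • P.vec σ v a b := by
  have h1 := act_d1Inv_d1 σ (P.vec σ v a b)
  rw [h.d1_vec, map_smul] at h1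
  rw [zpow_neg, eq_inv_smul_iff₀ (zpow_ne_zero _ q_ne_zero), h1]

theorem b1_bm1_vec (a b : ℕ) : σ B1 (σ Bm1 (P.vec σ v a b)) =
    σ Bm1 (σ B1 (P.vec σ v a b)) + qint (P.κ - 2 * (a + b)) • P.vec σ v a b := by
  have h1 : -(P.κ1 + a + b) + (P.κd - a - b) = P.κd - P.κ1 - 2 * (a + b) := by ring
  have h2 : -(P.κd - a - b) + (P.κ1 + a + b) = -(P.κd - P.κ1 - 2 * (a + b)) := by ring
  rw [act_b1_bm1, h.d1Inv_vec, h.ddInv_vec, map_smul, map_smul, h.dd_vec, h.d1_vec, smul_smul,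
    smul_smul, ← sub_smul, smul_smul, ← zpow_add₀ q_ne_zero, ← zpow_add₀ q_ne_zero, h1, h2, qint,
    κ, div_eq_inv_mul]

/-- The coefficient stays in front because the truncated subtraction `a - 1` is wrong at `a = 0`,
where the coefficient vanishes. The same holds for the next three lemmas. -/
theorem b0_cPlus (a b : ℕ) : P.cPlus a b • σ B0 (P.vec σ v (a - 1) b) =
    (P.cPlus a b * qbr P.μ (a - b - 1)) • P.vec σ v (a - 1) b := by
  cases a with
  | zero => simp [cPlus_zero]
  | succ a =>
    have e : ((a + 1 : ℕ) : ℤ) - b - 1 = (a : ℤ) - b := by push_cast; ring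
    rw [e, Nat.add_sub_cancel, h.b0_vec, smul_smul]

theorem b0_cMinus (a b : ℕ) : P.cMinus a b • σ B0 (P.vec σ v a (b - 1)) =
    (P.cMinus a b * qbr P.μ (a - b + 1)) • P.vec σ v a (b - 1) := by
  cases b with
  | zero => simp [cMinus_zero]
  | succ b =>
    have e : (a : ℤ) - ((b + 1 : ℕ) : ℤ) + 1 = (a : ℤ) - b := by push_cast; ring
    rw [e, Nat.add_sub_cancel, h.b0_vec, smul_smul]

theorem bm1_cPlus (a b : ℕ) : P.cPlus a b • σ Bm1 (P.vec σ v (a - 1) b) =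
    (P.cPlus a b * (P.br (a - b - 1))⁻¹) • (P.vec σ v a b + P.vec σ v (a - 1) (b + 1)) := by
  cases a with
  | zero => simp [cPlus_zero]
  | succ a =>
    have e : ((a + 1 : ℕ) : ℤ) - b - 1 = (a : ℤ) - b := by push_cast; ring
    rw [e, Nat.add_sub_cancel, h.bm1_vec, smul_smul]

theorem bm1_cMinus (a b : ℕ) : P.cMinus a b • σ Bm1 (P.vec σ v a (b - 1)) =
    (P.cMinus a b * (P.br (a - b + 1))⁻¹) • (P.vec σ v (a + 1) (b - 1) + P.vec σ v a b) := by
  cases b with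
  | zero => simp [cMinus_zero]
  | succ b =>
    have e : (a : ℤ) - ((b + 1 : ℕ) : ℤ) + 1 = (a : ℤ) - b := by push_cast; ring
    rw [e, Nat.add_sub_cancel, h.bm1_vec, smul_smul]

/-- The Serre relation gives this quadratic equation for `B_1` applied to `vec a b`, and the two
expected terms are eigenvectors for its two roots. -/
theorem b0_b0_defect (a b : ℕ) : σ B0 (σ B0 (P.defect σ v a b)) =
    (qbr P.μ (a - b + 1) + qbr P.μ (a - b - 1)) • σ B0 (P.defect σ v a b)
      - (qbr P.μ (a - b + 1) * qbr P.μ (a - b - 1)) • P.defect σ v a b := by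
  have hq := quadratic_b1 P.hμ (h.b0_vec a b)
  have hp := h.b0_cPlus a b
  have hm := h.b0_cMinus a b
  have hp2 := congrArg (σ B0) hp
  have hm2 := congrArg (σ B0) hm
  simp only [defect, map_sub, map_add, map_smul, hq] at hp2 hm2 ⊢
  rw [mul_comm (P.cPlus a b), mul_smul, hp] at hp2
  rw [mul_comm (P.cMinus a b), mul_smul, hm] at hm2
  rw [hp2, hm2, hp, hm]
  module

theorem defect_add {a b : ℕ} (h0 : P.defect σ v a b = 0) :
    P.defect σ v (a + 1) b + P.defect σ v a (b + 1) = 0 := by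
  have h1 := h.b1_bm1_vec a b
  rw [sub_eq_zero.mp h0, map_add, map_smul, map_smul, h.bm1_cPlus, h.bm1_cMinus, h.bm1_vec,
    map_smul, inv_smul_eq_iff₀ (P.br_ne_zero _), map_add] at h1
  have c1 := P.cPlus_add a b
  have c2 := P.cPlus_succ a b
  have c3 := P.cMinus_succ a b
  simp only [defect, Nat.add_sub_cancel, Nat.cast_add, Nat.cast_one]
  rw [sub_add_sub_comm, h1, c2, c3]
  match_scalars
  · linear_combination -c1
  · ring
  · ring

/-- Put `n = a - b`. The defects at `(a+1, b)` and `(a, b+1)` are opposite, so the first satisfies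
both quadratic equations, with roots `[μ;n], [μ;n+2]` and `[μ;n-2], [μ;n]`. Subtracting them leaves
the common root `[μ;n]`, as `[μ;n+2] ≠ [μ;n-2]`. -/
theorem b0_defect_left {a b : ℕ} (h0 : P.defect σ v a b = 0) :
    σ B0 (P.defect σ v (a + 1) b) = qbr P.μ (a - b) • P.defect σ v (a + 1) b := by
  have h1 := h.b0_b0_defect (a + 1) b
  have h2 := h.b0_b0_defect a (b + 1)
  have e1 : ((a + 1 : ℕ) : ℤ) - b = (a : ℤ) - b + 1 := by push_cast; ring
  have e2 : (a : ℤ) - ((b + 1 : ℕ) : ℤ) = (a : ℤ) - b - 1 := by push_cast; ring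
  rw [e1, add_sub_cancel_right] at h1
  rw [e2, sub_add_cancel, eq_neg_of_add_eq_zero_right (h.defect_add h0), map_neg, map_neg] at h2
  have hne : qbr P.μ (a - b + 1 + 1) - qbr P.μ (a - b - 1 - 1) ≠ 0 := fun hz => by
    have := qbr_injective P.hμ P.good (sub_eq_zero.mp hz)
    omega
  have h3 : (qbr P.μ (a - b + 1 + 1) - qbr P.μ (a - b - 1 - 1)) •
      (σ B0 (P.defect σ v (a + 1) b) - qbr P.μ (a - b) • P.defect σ v (a + 1) b) = 0 := by
    generalize σ B0 (σ B0 (P.defect σ v (a + 1) b)) = y at *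
    generalize σ B0 (P.defect σ v (a + 1) b) = y' at *
    linear_combination (norm := module) -h1 - h2
  exact sub_eq_zero.mp ((smul_eq_zero_iff_right hne).mp h3)

theorem b0_defect_right {a b : ℕ} (h0 : P.defect σ v a b = 0) :
    σ B0 (P.defect σ v a (b + 1)) = qbr P.μ (a - b) • P.defect σ v a (b + 1) := by
  rw [eq_neg_of_add_eq_zero_right (h.defect_add h0), map_neg, h.b0_defect_left h0, smul_neg]

theorem defect_zero : P.defect σ v 0 0 = 0 := by
  simp [defect, vec, h.b1, cPlus_zero, cMinus_zero]

/-- In degree one the commutator fixes only the sum of the two defects; the equation `Z v = ζ v`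
does the rest. Here `Y v` combines `vec 1 0` and `vec 0 1` with coefficients `μ/{0}` and `-μ⁻¹/{0}`,
and the defects are opposite, so `Z v` is `ζ v` plus `(μ + μ⁻¹)/{0} = 1` times the defect. -/
theorem defect_one : P.defect σ v 1 0 = 0 := by
  have h1 := h.defect_add h.defect_zero
  have h2 := h.z
  have h3 := h.bm1_vec 0 0
  have hb1 := h.b0_vec 1 0
  have hb2 := h.b0_vec 0 1
  have c1 := qbr_add_one_sub_qinv_mul P.μ 0
  have c2 := qbr_sub_one_sub_qinv_mul P.μ 0
  have hz := P.zEigen_zero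
  have hv : P.vec σ v 0 0 = v := by rw [vec]
  have g0 := P.br_ne_zero 0
  simp only [zEigen, zero_add, sub_self, zero_sub, neg_zero, zpow_zero, one_mul] at hz
  simp only [zero_add, Nat.cast_zero, Nat.cast_one, sub_self, sub_zero, zero_sub, neg_zero,
    zpow_zero, one_mul, hv] at h3 hb1 hb2 c1 c2 h1
  rw [act_Z, h.b1, map_zero, smul_zero, sub_zero, act_Y, h.b0, map_smul, h3] at h2
  simp only [map_smul, map_add, map_sub, hb1, hb2] at h2
  have d1 : σ B1 (P.vec σ v 1 0) = P.defect σ v 1 0 + (coeffPlus P.κ P.μ P.ζ 1 / P.br 1) • v := by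
    simp [defect, cPlus, cMinus_zero, hv]
  have d2 : σ B1 (P.vec σ v 0 1) =
      -P.defect σ v 1 0 + (coeffMinus P.κ P.μ P.ζ 1 / P.br (-1)) • v := by
    rw [← eq_neg_of_add_eq_zero_right h1]
    simp [defect, cMinus, cPlus_zero, hv]
  rw [d1, d2] at h2
  have hbr : P.br 0 = P.μ + P.μ⁻¹ := by simp [br, qpl]
  have h4 : (P.br 0)⁻¹ • (P.μ + P.μ⁻¹) • P.defect σ v 1 0 = 0 := by
    rw [← sub_eq_zero.mpr h2]
    match_scalars
    · linear_combination (P.br 0)⁻¹ * (c2 - c1)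
    · linear_combination (P.br 0)⁻¹ * (-(coeffPlus P.κ P.μ P.ζ 1 / P.br 1) * c1
        - coeffMinus P.κ P.μ P.ζ 1 / P.br (-1) * c2) - hz
  rwa [← hbr, inv_smul_smul₀ g0] at h4

theorem defect_eq_zero (k : ℕ) : ∀ a b, a + b = k → P.defect σ v a b = 0 := by
  induction k with
  | zero =>
    intro a b hab
    obtain ⟨rfl, rfl⟩ : a = 0 ∧ b = 0 := by omega
    exact h.defect_zero
  | succ k ih =>
    -- An interior defect has two predecessors, which give it the distinct `B_0`-eigenvalues
    -- `[μ;a-b-1]` and `[μ;a-b+1]`. The two ends of a diagonal are then the negatives of their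
    -- neighbours.
    have hmid : ∀ a b, (a + 1) + (b + 1) = k + 1 → P.defect σ v (a + 1) (b + 1) = 0 := by
      intro a b hab
      have h1 := h.b0_defect_left (ih a (b + 1) (by omega))
      have h2 := h.b0_defect_right (ih (a + 1) b (by omega))
      rw [h1, ← sub_eq_zero, ← sub_smul] at h2
      refine (smul_eq_zero_iff_right fun hz => ?_).mp h2
      have := qbr_injective P.hμ P.good (sub_eq_zero.mp hz)
      push_cast at this
      omega
    intro a b hab
    rcases a with _ | a
    · obtain rfl : b = k + 1 := by omega
      rw [eq_neg_of_add_eq_zero_right (h.defect_add (ih 0 k (by omega))), neg_eq_zero]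
      rcases k with _ | k
      · exact h.defect_one
      · exact hmid 0 k (by omega)
    · rcases b with _ | b
      · obtain rfl : a = k := by omega
        rcases a with _ | a
        · exact h.defect_one
        · rw [eq_neg_of_add_eq_zero_left (h.defect_add (ih (a + 1) 0 (by omega))), neg_eq_zero]
          exact hmid a 0 (by omega)
      · exact hmid a b hab

theorem b1_vec (a b : ℕ) : σ B1 (P.vec σ v a b) =
    P.cPlus a b • P.vec σ v (a - 1) b + P.cMinus a b • P.vec σ v a (b - 1) :=
  sub_eq_zero.mp (h.defect_eq_zero _ a b rfl)

/-- The span of the vectors `vec a b` is stable under `U_q'`. -/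
theorem act_mem_span (x : Uq') :
    σ x v ∈ Submodule.span Kq (Set.range fun p : ℕ × ℕ => P.vec σ v p.1 p.2) := by
  have hmem : ∀ a b, P.vec σ v a b ∈
      Submodule.span Kq (Set.range fun p : ℕ × ℕ => P.vec σ v p.1 p.2) :=
    fun a b => Submodule.subset_span ⟨(a, b), rfl⟩
  refine act_mem (fun g y hy => ?_) x v (by simpa [vec] using hmem 0 0)
  induction hy using Submodule.span_induction with
  | mem y hy =>
    obtain ⟨⟨a, b⟩, rfl⟩ := hy
    cases g with
    | b0 => exact (h.b0_vec a b) ▸ Submodule.smul_mem _ _ (hmem _ _)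
    | b1 =>
      exact (h.b1_vec a b) ▸ Submodule.add_mem _ (Submodule.smul_mem _ _ (hmem _ _))
        (Submodule.smul_mem _ _ (hmem _ _))
    | bm1 =>
      exact (h.bm1_vec a b) ▸ Submodule.smul_mem _ _ (Submodule.add_mem _ (hmem _ _) (hmem _ _))
    | dd => exact (h.dd_vec a b) ▸ Submodule.smul_mem _ _ (hmem _ _)
    | ddInv => exact (h.ddInv_vec a b) ▸ Submodule.smul_mem _ _ (hmem _ _)
    | d1 => exact (h.d1_vec a b) ▸ Submodule.smul_mem _ _ (hmem _ _)
    | d1Inv => exact (h.d1Inv_vec a b) ▸ Submodule.smul_mem _ _ (hmem _ _)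
  | zero => rw [map_zero]; exact Submodule.zero_mem _
  | add y z _ _ hy hz => rw [map_add]; exact Submodule.add_mem _ hy hz
  | smul t y _ hy => rw [map_smul]; exact Submodule.smul_mem _ _ hy

end IsHighest

end GoodWeight

/-! ### Homomorphisms out of Verma modules as singular vectors. -/

section Verma

variable {κd κ1 : ℤ} {β ζ : Kq}

/-- The highest weight vector of a Verma module. -/
def highest (κd κ1 : ℤ) (β ζ : Kq) : Verma κd κ1 β ζ := Submodule.Quotient.mk 1

theorem smul_highest (a : Uq') :
    a • highest κd κ1 β ζ = Submodule.Quotient.mk a := by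
  rw [highest, ← Submodule.Quotient.mk_smul, smul_eq_mul, mul_one]

/-- The relations defining homomorphisms out of the Verma module. -/
structure IsSingular {V : Type*} [AddCommGroup V] [Module Kq V] (κd κ1 : ℤ) (β ζ : Kq)
    (σ : Uq' →ₐ[Kq] Module.End Kq V) (w : V) : Prop where
  b1 : σ B1 w = 0
  x : σ X w = 0
  dd : σ Dd w = q ^ κd • w
  d1 : σ D1 w = q ^ κ1 • w
  b0 : σ B0 w = β • w
  z : σ Z w = ζ • w

/-- A singular vector is annihilated by the ideal defining the Verma module. -/
theorem IsSingular.annihilates {V : Type*} [AddCommGroup V] [Module Kq V]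
    {σ : Uq' →ₐ[Kq] Module.End Kq V} {w : V} (h : IsSingular κd κ1 β ζ σ w) {a : Uq'}
    (ha : a ∈ vermaIdeal κd κ1 β ζ) : σ a w = 0 := by
  induction ha using Submodule.span_induction with
  | mem a ha =>
    have hc : ∀ t : Kq, σ (algebraMap Kq Uq' t) w = t • w := fun t => by
      rw [AlgHom.commutes, Module.algebraMap_end_apply]
    rcases ha with rfl | rfl | rfl | rfl | rfl | rfl
    · exact h.b1
    · exact h.x
    · rw [map_sub, LinearMap.sub_apply, hc, h.dd, sub_self]
    · rw [map_sub, LinearMap.sub_apply, hc, h.d1, sub_self]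
    · rw [map_sub, LinearMap.sub_apply, hc, h.b0, sub_self]
    · rw [map_sub, LinearMap.sub_apply, hc, h.z, sub_self]
  | zero => rw [map_zero, LinearMap.zero_apply]
  | add a b _ _ ha hb => rw [map_add, LinearMap.add_apply, ha, hb, add_zero]
  | smul c a _ ha => rw [smul_eq_mul, map_mul, Module.End.mul_apply, ha, map_zero]

/-- The action of `U_q'` on a Verma module. -/
abbrev vermaAct (κd κ1 : ℤ) (β ζ : Kq) : Uq' →ₐ[Kq] Module.End Kq (Verma κd κ1 β ζ) :=
  Algebra.lsmul Kq Kq (Verma κd κ1 β ζ)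

theorem isSingular_highest :
    IsSingular κd κ1 β ζ (vermaAct κd κ1 β ζ) (highest κd κ1 β ζ) := by
  have hmem : ∀ a ∈ vermaIdeal κd κ1 β ζ, a • highest κd κ1 β ζ = 0 := fun a ha => by
    rw [smul_highest]
    exact (Submodule.Quotient.mk_eq_zero _).mpr ha
  have hsub : ∀ (a : Uq') (t : Kq), a - algebraMap Kq Uq' t ∈ vermaIdeal κd κ1 β ζ →
      a • highest κd κ1 β ζ = t • highest κd κ1 β ζ := fun a t ha => by
    have h1 := hmem _ ha
    rw [sub_smul, algebraMap_smul] at h1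
    exact sub_eq_zero.mp h1
  constructor
  · exact hmem _ (Submodule.subset_span (by simp))
  · exact hmem _ (Submodule.subset_span (by simp))
  · exact hsub _ _ (Submodule.subset_span (by simp))
  · exact hsub _ _ (Submodule.subset_span (by simp))
  · exact hsub _ _ (Submodule.subset_span (by simp))
  · exact hsub _ _ (Submodule.subset_span (by simp))

end Verma

section Hom

variable {κd κ1 κd' κ1' : ℤ} {β ζ β' ζ' : Kq}

theorem isSingular_apply (φ : VermaHom κd' κ1' β' ζ' κd κ1 β ζ) :
    IsSingular κd' κ1' β' ζ' (vermaAct κd κ1 β ζ) (φ (highest κd' κ1' β' ζ')) := by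
  have h := isSingular_highest (κd := κd') (κ1 := κ1') (β := β') (ζ := ζ')
  have hz : ∀ a : Uq', a • highest κd' κ1' β' ζ' = 0 → a • φ (highest κd' κ1' β' ζ') = 0 :=
    fun a ha => by rw [← map_smul, ha, map_zero]
  have hs : ∀ (a : Uq') (t : Kq), a • highest κd' κ1' β' ζ' = t • highest κd' κ1' β' ζ' →
      a • φ (highest κd' κ1' β' ζ') = t • φ (highest κd' κ1' β' ζ') := fun a t ha => by
    -- The map `φ` is given as `U_q'`-linear, so the scalar passes through it as an element of
    -- `U_q'`.
    have e1 : algebraMap Kq Uq' t • highest κd' κ1' β' ζ' = t • highest κd' κ1' β' ζ' :=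
      algebraMap_smul Uq' t (highest κd' κ1' β' ζ')
    have e2 : algebraMap Kq Uq' t • φ (highest κd' κ1' β' ζ') = t • φ (highest κd' κ1' β' ζ') :=
      algebraMap_smul Uq' t (φ (highest κd' κ1' β' ζ'))
    rw [← map_smul, ha, ← e1, map_smul, e2]
  exact ⟨hz _ h.b1, hz _ h.x, hs _ _ h.dd, hs _ _ h.d1, hs _ _ h.b0, hs _ _ h.z⟩

theorem hom_ext {φ ψ : VermaHom κd' κ1' β' ζ' κd κ1 β ζ}
    (h : φ (highest κd' κ1' β' ζ') = ψ (highest κd' κ1' β' ζ')) : φ = ψ := by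
  refine LinearMap.ext fun x => ?_
  obtain ⟨a, rfl⟩ := Submodule.Quotient.mk_surjective _ x
  rw [← smul_highest, map_smul, map_smul, h]

theorem exists_hom {w : Verma κd κ1 β ζ}
    (h : IsSingular κd' κ1' β' ζ' (vermaAct κd κ1 β ζ) w) :
    ∃ φ : VermaHom κd' κ1' β' ζ' κd κ1 β ζ, φ (highest κd' κ1' β' ζ') = w := by
  have hle : vermaIdeal κd' κ1' β' ζ' ≤ LinearMap.ker (LinearMap.toSpanSingleton Uq' _ w) :=
    fun a ha => LinearMap.mem_ker.mpr (h.annihilates ha)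
  exact ⟨Submodule.liftQ _ _ hle, one_smul Uq' w⟩

end Hom

/-! ### The basis of a good Verma module and its singular vectors. -/

namespace GoodWeight

variable (P : GoodWeight)

/-- The good Verma module. -/
abbrev M : Type := Verma P.κd P.κ1 (qbr P.μ 0) P.ζ

/-- The action on the good Verma module. -/
abbrev act : Uq' →ₐ[Kq] Module.End Kq P.M := vermaAct P.κd P.κ1 (qbr P.μ 0) P.ζ

/-- The highest weight vector of the good Verma module. -/
abbrev hw : P.M := highest P.κd P.κ1 (qbr P.μ 0) P.ζ

theorem isHighest_hw : P.IsHighest P.act P.hw :=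
  ⟨isSingular_highest.b1, isSingular_highest.dd, isSingular_highest.d1, isSingular_highest.b0,
    isSingular_highest.z⟩

theorem isSingular_W {a b : ℤ} (hp : P.cPlus a b = 0) (hm : P.cMinus a b = 0) :
    IsSingular (P.κd - a - b) (P.κ1 + a + b) (qbr P.μ (a - b)) (P.zEigen a b) P.rep (W a b) := by
  constructor
  · rw [B1, rep_u, op_b1, hp, hm, zero_smul, zero_smul, add_zero]
  · exact P.rep_X_W a b hp hm
  · rw [Dd, rep_u, op_dd]
  · rw [D1, rep_u, op_d1]
  · rw [B0, rep_u, op_b0]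
  · exact P.rep_Z_W a b hp hm

theorem isSingular_W_zero :
    IsSingular P.κd P.κ1 (qbr P.μ 0) P.ζ P.rep (W 0 0) := by
  simpa [zEigen_zero] using P.isSingular_W (P.cPlus_zero 0) (P.cMinus_zero 0)

/-- The map from the good Verma module to the lattice representation. -/
def toLattice : P.M →+ Lattice :=
  QuotientAddGroup.lift (vermaIdeal P.κd P.κ1 (qbr P.μ 0) P.ζ).toAddSubgroup
    ((LinearMap.applyₗ (W 0 0)).toAddMonoidHom.comp (P.rep : Uq' →+ Module.End Kq Lattice))
    fun _ ha => P.isSingular_W_zero.annihilates ha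

theorem toLattice_mk (a : Uq') :
    P.toLattice (Submodule.Quotient.mk a) = P.rep a (W 0 0) := rfl

theorem toLattice_act (a : Uq') (x : P.M) :
    P.toLattice (P.act a x) = P.rep a (P.toLattice x) := by
  obtain ⟨c, rfl⟩ := Submodule.Quotient.mk_surjective _ x
  change P.toLattice (Submodule.Quotient.mk (a * c)) = _
  rw [toLattice_mk, toLattice_mk, map_mul, Module.End.mul_apply]

theorem toLattice_smul (t : Kq) (x : P.M) : P.toLattice (t • x) = t • P.toLattice x := by
  rw [← algebraMap_smul Uq' t x]
  change P.toLattice (P.act _ x) = _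
  rw [toLattice_act, AlgHom.commutes, Module.algebraMap_end_apply]

/-- The basis vectors of the good Verma module. -/
def basisVec (a b : ℕ) : P.M := P.vec P.act P.hw a b

theorem toLattice_basisVec (a b : ℕ) : P.toLattice (P.basisVec a b) = W a b := by
  -- On the lattice the two parts of `B_{-1}` are pure shifts: the factor `[μ;n+1] - [μ;n-1] = {n}`
  -- cancels the normalisation `{n}⁻¹` of `B_{-1}`.
  have key : ∀ a b : ℤ, P.op .b0 (P.op .bm1 (W a b)) - qbr P.μ (a - b - 1) • P.op .bm1 (W a b)
      = W (a + 1) b ∧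
      qbr P.μ (a - b + 1) • P.op .bm1 (W a b) - P.op .b0 (P.op .bm1 (W a b)) = W a (b + 1) := by
    intro a b
    have h1 := qbr_add_one_sub P.μ (a - b)
    have h2 : P.br (a - b) ≠ 0 := P.br_ne_zero _
    have e1 : a + 1 - b = a - b + 1 := by ring
    have e2 : a - (b + 1) = a - b - 1 := by ring
    change _ = P.br (a - b) at h1
    simp only [op_bm1, map_smul, map_add, op_b0, e1, e2]
    constructor
    · match_scalars
      · field_simp
        linear_combination h1
      · ring
    · match_scalars
      · ring
      · field_simp
        linear_combination h1
  rw [basisVec]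
  induction a with
  | zero =>
    induction b with
    | zero =>
      rw [vec, hw, highest, toLattice_mk, map_one]
      rfl
    | succ b ih =>
      rw [vec, map_sub, toLattice_smul, toLattice_act, toLattice_act, toLattice_act, ih, B0, Bm1,
        rep_u, rep_u]
      exact_mod_cast (key 0 b).2
  | succ a ih =>
    rw [vec, map_sub, toLattice_smul, toLattice_act, toLattice_act, ih, B0, Bm1, rep_u, rep_u]
    exact_mod_cast (key a b).1

theorem mem_span_basisVec (x : P.M) :
    x ∈ Submodule.span Kq (Set.range fun p : ℕ × ℕ => P.basisVec p.1 p.2) := by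
  obtain ⟨a, rfl⟩ := Submodule.Quotient.mk_surjective _ x
  have h := P.isHighest_hw.act_mem_span a
  change a • P.hw ∈ _ at h
  rwa [smul_highest] at h

/-- `toLattice` as a linear map. -/
def toLatticeₗ : P.M →ₗ[Kq] Lattice where
  __ := P.toLattice
  map_smul' := P.toLattice_smul

theorem toLattice_injective : Function.Injective P.toLattice := by
  refine (injective_iff_map_eq_zero _).mpr fun x hx => ?_
  obtain ⟨c, rfl⟩ := (Finsupp.mem_span_range_iff_exists_finsupp).mp (P.mem_span_basisVec x)
  have hinj : Function.Injective fun p : ℕ × ℕ => ((p.1 : ℤ), (p.2 : ℤ)) := fun p r h => by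
    simpa [Prod.ext_iff] using h
  have h1 : P.toLatticeₗ (c.sum fun p t => t • P.basisVec p.1 p.2) =
      c.mapDomain fun p : ℕ × ℕ => ((p.1 : ℤ), (p.2 : ℤ)) := by
    rw [map_finsuppSum, Finsupp.mapDomain]
    refine Finsupp.sum_congr fun p _ => ?_
    rw [map_smul]
    change _ • P.toLattice _ = _
    rw [toLattice_basisVec, W, Finsupp.smul_single, smul_eq_mul, mul_one]
  have h2 : c = 0 := Finsupp.mapDomain_injective hinj (by
    rw [← h1, Finsupp.mapDomain_zero]
    exact hx)
  rw [h2, Finsupp.sum_zero_index]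

theorem nonneg_of_toLattice_ne_zero (x : P.M) {p : ℤ × ℤ} (hp : P.toLattice x p ≠ 0) :
    ∃ a b : ℕ, p = ((a : ℤ), (b : ℤ)) := by
  contrapose! hp
  have h := P.mem_span_basisVec x
  induction h using Submodule.span_induction with
  | mem x hx =>
    obtain ⟨⟨a, b⟩, rfl⟩ := hx
    rw [toLattice_basisVec, W, Finsupp.single_apply, if_neg (hp a b).symm]
  | zero => rw [map_zero, Finsupp.zero_apply]
  | add x y _ _ hx hy => rw [map_add, Finsupp.add_apply, hx, hy, add_zero]
  | smul t x _ hx => rw [toLattice_smul, Finsupp.smul_apply, hx, smul_zero]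

theorem extend_diagonal_apply (t : ℤ → ℤ → Kq) (y : Lattice) (p : ℤ × ℤ) :
    extend (fun a b => t a b • W a b) y p = t p.1 p.2 * y p := by
  classical
  induction y using Finsupp.induction_linear with
  | zero => simp
  | add y z hy hz => rw [map_add, Finsupp.add_apply, hy, hz, Finsupp.add_apply, mul_add]
  | single r c =>
    rw [extend, Finsupp.linearCombination_single, Finsupp.smul_apply, Finsupp.smul_apply, W,
      Finsupp.single_apply, Finsupp.single_apply]
    by_cases h : r = p
    · subst h
      simp [mul_comm]
    · simp [h]

theorem op_dd_apply (y : Lattice) (p : ℤ × ℤ) :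
    P.op .dd y p = q ^ (P.κd - p.1 - p.2) * y p := by
  rw [op, extend_diagonal_apply]

theorem op_b0_apply (y : Lattice) (p : ℤ × ℤ) :
    P.op .b0 y p = qbr P.μ (p.1 - p.2) * y p := by
  rw [op, extend_diagonal_apply]

/-- A common eigenvector of `D̂_◇` and `B_0` is a multiple of a basis vector. -/
theorem eq_smul_basisVec {x : P.M} (hx : x ≠ 0) {κd' : ℤ} {β' : Kq}
    (hd : P.act Dd x = q ^ κd' • x) (hb : P.act B0 x = β' • x) :
    ∃ (a b : ℕ) (t : Kq), t ≠ 0 ∧ x = t • P.basisVec a b ∧ κd' = P.κd - a - b ∧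
      β' = qbr P.μ (a - b) := by
  have hx' : P.toLattice x ≠ 0 := fun h => hx (P.toLattice_injective (by rw [h, map_zero]))
  have hd' := congrArg P.toLattice hd
  have hb' := congrArg P.toLattice hb
  rw [toLattice_act, toLattice_smul, Dd, rep_u] at hd'
  rw [toLattice_act, toLattice_smul, B0, rep_u] at hb'
  -- The `D̂_◇`-eigenvalue determines `a + b` and, by goodness, the `B_0`-eigenvalue determines `a -
  -- b`, so the support is a single point.
  have hsupp : ∀ p, P.toLattice x p ≠ 0 →
      κd' = P.κd - p.1 - p.2 ∧ β' = qbr P.μ (p.1 - p.2) := by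
    intro p hp
    have h1 := DFunLike.congr_fun hd' p
    have h2 := DFunLike.congr_fun hb' p
    rw [op_dd_apply, Finsupp.smul_apply, smul_eq_mul] at h1
    rw [op_b0_apply, Finsupp.smul_apply, smul_eq_mul] at h2
    exact ⟨(q_zpow_injective (mul_right_cancel₀ hp h1)).symm, (mul_right_cancel₀ hp h2).symm⟩
  obtain ⟨p, hp⟩ := Finsupp.ne_iff.mp hx'
  rw [Finsupp.zero_apply] at hp
  obtain ⟨a, b, rfl⟩ := P.nonneg_of_toLattice_ne_zero x hp
  obtain ⟨h1, h2⟩ := hsupp _ hp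
  refine ⟨a, b, P.toLattice x (a, b), hp, P.toLattice_injective ?_, h1, h2⟩
  rw [toLattice_smul, toLattice_basisVec, W, Finsupp.smul_single, smul_eq_mul, mul_one]
  refine Finsupp.ext fun r => ?_
  by_cases hr : P.toLattice x r = 0
  · rw [hr, Finsupp.single_apply]
    split_ifs with h
    · rw [h, hr]
    · rfl
  · obtain ⟨h3, h4⟩ := hsupp r hr
    have h5 := qbr_injective P.hμ P.good (h2.symm.trans h4)
    dsimp only at h1 h5
    have : r = ((a : ℤ), (b : ℤ)) := Prod.ext (by dsimp only; omega) (by dsimp only; omega)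
    rw [this, Finsupp.single_eq_same]

/-- The pairs `(a, b)` for which the basis vector is singular with the given weight. -/
structure SingularAt (κd' κ1' : ℤ) (β' ζ' : Kq) (a b : ℕ) : Prop where
  κd_eq : κd' = P.κd - a - b
  κ1_eq : κ1' = P.κ1 + a + b
  β_eq : β' = qbr P.μ (a - b)
  plus : P.cPlus a b = 0
  minus : P.cMinus a b = 0
  ζ_eq : ζ' = P.zEigen a b

variable {P} {κd' κ1' : ℤ} {β' ζ' : Kq}

theorem SingularAt.isSingular {a b : ℕ} (h : P.SingularAt κd' κ1' β' ζ' a b) :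
    IsSingular κd' κ1' β' ζ' P.act (P.basisVec a b) := by
  obtain ⟨rfl, rfl, rfl, hp, hm, rfl⟩ := h
  have h := P.isSingular_W hp hm
  have hz : ∀ c : Uq', P.rep c (W a b) = 0 → P.act c (P.basisVec a b) = 0 := fun c hc =>
    P.toLattice_injective (by rw [toLattice_act, toLattice_basisVec, hc, map_zero])
  have hs : ∀ (c : Uq') (t : Kq), P.rep c (W a b) = t • W a b →
      P.act c (P.basisVec a b) = t • P.basisVec a b := fun c t hc =>
    P.toLattice_injective (by
      rw [toLattice_act, toLattice_smul, toLattice_basisVec, hc])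
  exact ⟨hz _ h.b1, hz _ h.x, hs _ _ h.dd, hs _ _ h.d1, hs _ _ h.b0, hs _ _ h.z⟩

theorem exists_singularAt {x : P.M} (hx : x ≠ 0) (h : IsSingular κd' κ1' β' ζ' P.act x) :
    ∃ (a b : ℕ) (t : Kq), t ≠ 0 ∧ x = t • P.basisVec a b ∧
      P.SingularAt κd' κ1' β' ζ' a b := by
  obtain ⟨a, b, t, ht, rfl, h1, h2⟩ := P.eq_smul_basisVec hx h.dd h.b0
  refine ⟨a, b, t, ht, rfl, ?_⟩
  have key : ∀ (c : Uq') (s : Kq), P.act c (t • P.basisVec a b) = s • t • P.basisVec a b →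
      P.rep c (W a b) = s • W a b := fun c s hc => by
    rw [map_smul, smul_comm s t] at hc
    have hc' := congrArg P.toLattice (smul_right_injective _ ht hc)
    rwa [toLattice_act, toLattice_smul, toLattice_basisVec] at hc'
  have hW : (W a b : Lattice) (a, b) = 1 := by rw [W, Finsupp.single_eq_same]
  have hB1 := key B1 0 (h.b1.trans (zero_smul Kq (t • P.basisVec a b : P.M)).symm)
  rw [zero_smul, B1, rep_u, op_b1] at hB1
  have hp := DFunLike.congr_fun hB1 ((a : ℤ) - 1, (b : ℤ))
  have hm := DFunLike.congr_fun hB1 ((a : ℤ), (b : ℤ) - 1)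
  simp [W] at hp hm
  have hD := key D1 _ h.d1
  rw [D1, rep_u, op_d1] at hD
  have hD' := DFunLike.congr_fun hD ((a : ℤ), (b : ℤ))
  rw [Finsupp.smul_apply, Finsupp.smul_apply, hW, smul_eq_mul, smul_eq_mul, mul_one,
    mul_one] at hD'
  have hZ := key Z _ h.z
  rw [P.rep_Z_W a b hp hm] at hZ
  have hZ' := DFunLike.congr_fun hZ ((a : ℤ), (b : ℤ))
  rw [Finsupp.smul_apply, Finsupp.smul_apply, hW, smul_eq_mul, smul_eq_mul, mul_one,
    mul_one] at hZ'
  exact ⟨h1, (q_zpow_injective hD').symm, h2, hp, hm, hZ'.symm⟩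

theorem SingularAt.unique {a b c d : ℕ} (h : P.SingularAt κd' κ1' β' ζ' a b)
    (h' : P.SingularAt κd' κ1' β' ζ' c d) : a = c ∧ b = d := by
  have h1 := h.κd_eq.symm.trans h'.κd_eq
  have h2 := qbr_injective P.hμ P.good (h.β_eq.symm.trans h'.β_eq)
  omega

variable (P)

/-- Nonzero homomorphisms into a good Verma module correspond to singular basis vectors. -/
theorem exists_hom_iff :
    (∃ φ : VermaHom κd' κ1' β' ζ' P.κd P.κ1 (qbr P.μ 0) P.ζ, φ ≠ 0) ↔
      ∃ a b : ℕ, P.SingularAt κd' κ1' β' ζ' a b := by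
  constructor
  · rintro ⟨φ, hφ⟩
    have hne : φ (highest κd' κ1' β' ζ') ≠ 0 := fun h => hφ (hom_ext (by simpa using h))
    obtain ⟨a, b, -, -, -, h⟩ := exists_singularAt hne (isSingular_apply φ)
    exact ⟨a, b, h⟩
  · rintro ⟨a, b, h⟩
    obtain ⟨φ, hφ⟩ := exists_hom h.isSingular
    refine ⟨φ, fun h0 => ?_⟩
    have h1 : P.toLattice (P.basisVec a b) = 0 := by
      rw [← hφ, h0, LinearMap.zero_apply, map_zero]
    rw [toLattice_basisVec, W, Finsupp.single_eq_zero] at h1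
    exact one_ne_zero h1

theorem finrank_hom (φ : VermaHom κd' κ1' β' ζ' P.κd P.κ1 (qbr P.μ 0) P.ζ) (hφ : φ ≠ 0) :
    Module.finrank Kq (VermaHom κd' κ1' β' ζ' P.κd P.κ1 (qbr P.μ 0) P.ζ) = 1 := by
  have hz : ∀ ψ : VermaHom κd' κ1' β' ζ' P.κd P.κ1 (qbr P.μ 0) P.ζ, ψ ≠ 0 →
      ψ (highest κd' κ1' β' ζ') ≠ 0 := fun ψ hψ h => hψ (hom_ext (by simpa using h))
  obtain ⟨a, b, t, ht, hw, h⟩ := exists_singularAt (hz φ hφ) (isSingular_apply φ)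
  refine (finrank_eq_one_iff_of_nonzero' φ hφ).mpr fun ψ => ?_
  by_cases hψ : ψ = 0
  · exact ⟨0, (zero_smul Kq φ).trans hψ.symm⟩
  obtain ⟨c, d, s, hs, hw', h'⟩ := exists_singularAt (hz ψ hψ) (isSingular_apply ψ)
  obtain ⟨rfl, rfl⟩ := h.unique h'
  refine ⟨s * t⁻¹, hom_ext ?_⟩
  rw [LinearMap.smul_apply, hw, hw']
  exact (smul_smul (s * t⁻¹) t (P.basisVec a b)).trans (by rw [inv_mul_cancel_right₀ ht])

end GoodWeight

/-! ### Vanishing of the coefficients of `B_1`, and the eigenvalue of `Z` in each case. -/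

theorem zetaMinus_sub_succ (κ : ℤ) {μ : Kq} (hμ : μ ≠ 0) (i : ℤ) :
    zetaMinus κ μ i - zetaMinus κ μ (i + 1) = qpl μ (κ - 2 * i - 1) := by
  have h0 := q_sq_sub_one_ne_zero
  have hq := q_ne_zero
  have h1 := zpow_ne_zero i q_ne_zero
  have h3 := zpow_ne_zero κ q_ne_zero
  simp only [zetaMinus, qint, qpl, neg_add, two_mul,
    sub_eq_add_neg, neg_neg, zpow_add₀ hq, zpow_neg, zpow_one]
  generalize q ^ i = x at *
  generalize q ^ κ = k at *
  rw [q_add_neg_inv]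
  field_simp
  ring

theorem zetaPlus_sub_succ (κ : ℤ) {μ : Kq} (hμ : μ ≠ 0) (i : ℤ) :
    zetaPlus κ μ i - zetaPlus κ μ (i + 1) = -qpl μ (2 * i + 1 - κ) := by
  have h0 := q_sq_sub_one_ne_zero
  have hq := q_ne_zero
  have h1 := zpow_ne_zero i q_ne_zero
  have h3 := zpow_ne_zero κ q_ne_zero
  simp only [zetaPlus, qint, qpl, neg_add, two_mul,
    sub_eq_add_neg, neg_neg, zpow_add₀ hq, zpow_neg, zpow_one]
  generalize q ^ i = x at *
  generalize q ^ κ = k at *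
  rw [q_add_neg_inv]
  field_simp
  ring

namespace GoodWeight

variable {P : GoodWeight}

theorem cPlus_eq_zero_iff {a : ℕ} {b : ℤ} :
    P.cPlus a b = 0 ↔ a = 0 ∨ P.ζ = zetaPlus P.κ P.μ (a - 1) := by
  rw [cPlus, div_eq_zero_iff, or_iff_left (P.br_ne_zero _), coeffPlus, mul_eq_zero, mul_eq_zero,
    or_iff_left (qpl_ne_zero P.hμ P.good _), sub_eq_zero]
  refine or_congr_left ⟨fun h => ?_, fun h => ?_⟩
  · by_contra ha
    exact qint_ne_zero (Nat.cast_ne_zero.mpr ha) h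
  · rw [h, Nat.cast_zero, qint_zero]

theorem cMinus_eq_zero_iff {a : ℤ} {b : ℕ} :
    P.cMinus a b = 0 ↔ b = 0 ∨ P.ζ = zetaMinus P.κ P.μ (b - 1) := by
  rw [cMinus, div_eq_zero_iff, or_iff_left (P.br_ne_zero _), coeffMinus, neg_eq_zero, mul_eq_zero,
    mul_eq_zero, or_iff_left (qpl_ne_zero P.hμ P.good _), sub_eq_zero]
  refine or_congr_left ⟨fun h => ?_, fun h => ?_⟩
  · by_contra ha
    exact qint_ne_zero (Nat.cast_ne_zero.mpr ha) h
  · rw [h, Nat.cast_zero, qint_zero]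

/-- At this `ζ` the differences from `ζ⁺(0)` and `ζ⁻(i+1)` factor, and the inner denominators `{-i}`
and `{-(i+2)}` cancel. What remains is an identity of Laurent polynomials in `q^i`, `q^κ`, `q` and
`μ` after clearing `q - q⁻¹`. -/
theorem zEigen_minus {i : ℤ} (hζ : P.ζ = zetaMinus P.κ P.μ i) :
    P.zEigen 0 (i + 1) = P.μ * q * qint (P.κ - i)
      + P.μ⁻¹ * q ^ (2 * i + 1 - P.κ) * qint (i + 2) := by
  have h1 : P.ζ - zetaPlus P.κ P.μ 0 = qint (P.κ - i) * qpl P.μ (-i) := by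
    rw [hζ, zetaMinus_sub_zetaPlus _ P.hμ, sub_zero, zero_sub]
  have h2 : P.ζ - zetaMinus P.κ P.μ (i + 1) = qpl P.μ (P.κ - 2 * i - 1) := by
    rw [hζ, zetaMinus_sub_succ _ P.hμ]
  have e1 : 0 - (i + 1) + 1 = -i := by ring
  have e2 : 0 - (i + 1) - 1 = -(i + 2) := by ring
  have e3 : i + 1 + 1 = i + 2 := by ring
  have e4 : i + 2 - 1 = i + 1 := by ring
  have g1 := P.br_ne_zero (0 - (i + 1))
  have g2 := P.br_ne_zero (-i)
  have g3 := P.br_ne_zero (-(i + 2))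
  rw [zEigen, div_eq_iff g1, e1, e2, e3, coeffPlus, coeffMinus, zero_add, sub_self, e4, h1, h2,
    qint_one]
  simp only [br] at g1 g2 g3 ⊢
  have h3 : q ^ (0 - (i + 1)) * P.μ * (1 * qpl P.μ 1 * (qint (P.κ - i) * qpl P.μ (-i)))
      / qpl P.μ (-i) = q ^ (0 - (i + 1)) * P.μ * qpl P.μ 1 * qint (P.κ - i) := by
    field_simp
  have h4 : q ^ (-(0 - (i + 1))) * P.μ⁻¹ *
      -(qint (i + 2) * qpl P.μ (-(i + 2)) * qpl P.μ (P.κ - 2 * i - 1)) / qpl P.μ (-(i + 2)) =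
      -(q ^ (-(0 - (i + 1))) * P.μ⁻¹ * qint (i + 2) * qpl P.μ (P.κ - 2 * i - 1)) := by
    field_simp
  rw [h3, h4]
  clear h1 h2 h3 h4 g1 g2 g3 hζ
  have h0 := q_sq_sub_one_ne_zero
  have hq := q_ne_zero
  have hμ := P.hμ
  have h1 := zpow_ne_zero i q_ne_zero
  have h3 := zpow_ne_zero P.κ q_ne_zero
  have hz : q ^ (2 : ℤ) = q ^ 2 := zpow_ofNat q 2
  simp only [qint, qpl, neg_add, two_mul, zero_add,
    sub_eq_add_neg, neg_neg, zpow_add₀ hq, zpow_neg, zpow_one, hz]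
  generalize q ^ i = x at *
  generalize q ^ P.κ = k at *
  rw [q_add_neg_inv]
  field_simp
  ring

theorem zEigen_plus {i : ℤ} (hζ : P.ζ = zetaPlus P.κ P.μ i) :
    P.zEigen (i + 1) 0 = -(P.μ * q ^ (2 * i + 1 - P.κ) * qint (i + 2))
      - P.μ⁻¹ * q * qint (P.κ - i) := by
  have h1 : P.ζ - zetaMinus P.κ P.μ 0 = -(qint (P.κ - i) * qpl P.μ i) := by
    have := zetaMinus_sub_zetaPlus P.κ P.hμ 0 i
    rw [sub_zero, sub_zero] at this
    rw [hζ, ← this, neg_sub]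
  have h2 : P.ζ - zetaPlus P.κ P.μ (i + 1) = -qpl P.μ (2 * i + 1 - P.κ) := by
    rw [hζ, zetaPlus_sub_succ _ P.hμ]
  have e1 : i + 1 - 0 + 1 = i + 2 := by ring
  have e2 : i + 1 - 0 - 1 = i := by ring
  have e3 : i + 1 + 1 = i + 2 := by ring
  have e4 : i + 2 - 1 = i + 1 := by ring
  have g1 := P.br_ne_zero (i + 1 - 0)
  have g2 := P.br_ne_zero i
  have g3 := P.br_ne_zero (i + 2)
  rw [zEigen, div_eq_iff g1, e1, e2, e3, coeffPlus, coeffMinus, zero_add, sub_self, e4, h1, h2,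
    qint_one]
  simp only [br] at g1 g2 g3 ⊢
  have h3 : q ^ (i + 1 - 0) * P.μ * (qint (i + 2) * qpl P.μ (i + 2) * -qpl P.μ (2 * i + 1 - P.κ))
      / qpl P.μ (i + 2) = -(q ^ (i + 1 - 0) * P.μ * qint (i + 2) * qpl P.μ (2 * i + 1 - P.κ)) := by
    field_simp
  have h4 : q ^ (-(i + 1 - 0)) * P.μ⁻¹ *
      -(1 * qpl P.μ (-1) * -(qint (P.κ - i) * qpl P.μ i)) / qpl P.μ i =
      q ^ (-(i + 1 - 0)) * P.μ⁻¹ * qpl P.μ (-1) * qint (P.κ - i) := by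
    field_simp
  rw [h3, h4]
  clear h1 h2 h3 h4 g1 g2 g3 hζ
  have h0 := q_sq_sub_one_ne_zero
  have hq := q_ne_zero
  have hμ := P.hμ
  have h1 := zpow_ne_zero i q_ne_zero
  have h3 := zpow_ne_zero P.κ q_ne_zero
  have hz : q ^ (2 : ℤ) = q ^ 2 := zpow_ofNat q 2
  simp only [qint, qpl, neg_add, two_mul, neg_zero, add_zero,
    sub_eq_add_neg, neg_neg, zpow_add₀ hq, zpow_neg, zpow_one, hz]
  generalize q ^ i = x at *
  generalize q ^ P.κ = k at *
  rw [q_add_neg_inv]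
  field_simp
  ring

/-- This symmetry is why the third case needs one equation for `ζ`: the vanishing of the other
coefficient, at index `κ - i`, comes for free. -/
theorem zetaPlus_sub (κ i : ℤ) (μ : Kq) : zetaPlus κ μ (κ - i) = zetaMinus κ μ i := by
  have e1 : κ - i - κ = -i := by ring
  have e2 : κ - (κ - i) = i := by ring
  have e3 : -(κ - i) = i - κ := by ring
  rw [zetaPlus, zetaMinus, e1, e2, e3]

theorem zEigen_both {i : ℤ} (hζ : P.ζ = zetaMinus P.κ P.μ i) :
    P.zEigen (P.κ - i + 1) (i + 1) = P.μ⁻¹ * q ^ (i + 2) * qint (i + 2)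
      - P.μ * q ^ (P.κ - i + 2) * qint (P.κ - i + 2) := by
  have h1 : P.ζ - zetaPlus P.κ P.μ (P.κ - i + 1) = -qpl P.μ (P.κ - 2 * i + 1) := by
    have e : 2 * (P.κ - i) + 1 - P.κ = P.κ - 2 * i + 1 := by ring
    rw [hζ, ← zetaPlus_sub, zetaPlus_sub_succ _ P.hμ, e]
  have h2 : P.ζ - zetaMinus P.κ P.μ (i + 1) = qpl P.μ (P.κ - 2 * i - 1) := by
    rw [hζ, zetaMinus_sub_succ _ P.hμ]
  have e0 : P.κ - i + 1 - (i + 1) = P.κ - 2 * i := by ring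
  have e1 : P.κ - i + 1 + 1 = P.κ - i + 2 := by ring
  have e2 : P.κ - i + 2 - 1 = P.κ - i + 1 := by ring
  have e3 : i + 1 + 1 = i + 2 := by ring
  have e4 : i + 2 - 1 = i + 1 := by ring
  have g1 := P.br_ne_zero (P.κ - 2 * i)
  have g2 := P.br_ne_zero (P.κ - 2 * i + 1)
  have g3 := P.br_ne_zero (P.κ - 2 * i - 1)
  rw [zEigen, e0, div_eq_iff g1, coeffPlus, coeffMinus, e1, e2, e3, e4, h1, h2]
  simp only [br] at g1 g2 g3 ⊢
  have h3 : q ^ (P.κ - 2 * i) * P.μ * (qint (P.κ - i + 2) * qpl P.μ (P.κ - i + 2) *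
      -qpl P.μ (P.κ - 2 * i + 1)) / qpl P.μ (P.κ - 2 * i + 1) =
      -(q ^ (P.κ - 2 * i) * P.μ * qint (P.κ - i + 2) * qpl P.μ (P.κ - i + 2)) := by
    field_simp
  have h4 : q ^ (-(P.κ - 2 * i)) * P.μ⁻¹ *
      -(qint (i + 2) * qpl P.μ (-(i + 2)) * qpl P.μ (P.κ - 2 * i - 1))
        / qpl P.μ (P.κ - 2 * i - 1) =
      -(q ^ (-(P.κ - 2 * i)) * P.μ⁻¹ * qint (i + 2) * qpl P.μ (-(i + 2))) := by
    field_simp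
  rw [h3, h4]
  clear h1 h2 h3 h4 g1 g2 g3 hζ
  have h0 := q_sq_sub_one_ne_zero
  have hq := q_ne_zero
  have hμ := P.hμ
  have h1 := zpow_ne_zero i q_ne_zero
  have h3 := zpow_ne_zero P.κ q_ne_zero
  have hz : q ^ (2 : ℤ) = q ^ 2 := zpow_ofNat q 2
  simp only [qint, qpl, neg_add, two_mul,
    sub_eq_add_neg, neg_neg, zpow_add₀ hq, zpow_neg, hz]
  generalize q ^ i = x at *
  generalize q ^ P.κ = k at *
  rw [q_add_neg_inv]
  field_simp
  ring

/-- The two families of exceptional values of `ζ` meet only in complementary degrees. -/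
theorem add_eq_of_zeta_eq {i j : ℤ} (h : zetaMinus P.κ P.μ i = zetaPlus P.κ P.μ j) :
    i + j = P.κ := by
  have h1 := zetaMinus_sub_zetaPlus P.κ P.hμ i j
  rw [h, sub_self] at h1
  have h2 := (mul_eq_zero.mp h1.symm).resolve_right (qpl_ne_zero P.hμ P.good _)
  by_contra hne
  exact qint_ne_zero (by omega) h2

/-- In the order of the disjunction, `(a, b)` is `(0, i+1)`, `(i+1, 0)`, `(κ-i+1, i+1)` and `(0,
0)`. -/
theorem exists_singularAt_iff {κd' κ1' : ℤ} {β' ζ' : Kq} :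
    (∃ a b : ℕ, P.SingularAt κd' κ1' β' ζ' a b) ↔ ∃ i : ℕ,
      (P.ζ = zetaMinus P.κ P.μ i ∧ κd' = P.κd - i - 1 ∧ κ1' = P.κ1 + i + 1 ∧
        β' = qbr P.μ (-((i : ℤ) + 1)) ∧
        ζ' = P.μ * q * qint (P.κ - i) + P.μ⁻¹ * q ^ (2 * (i : ℤ) + 1 - P.κ) * qint (i + 2)) ∨
      (P.ζ = zetaPlus P.κ P.μ i ∧ κd' = P.κd - i - 1 ∧ κ1' = P.κ1 + i + 1 ∧
        β' = qbr P.μ ((i : ℤ) + 1) ∧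
        ζ' = -(P.μ * q ^ (2 * (i : ℤ) + 1 - P.κ) * qint (i + 2)) - P.μ⁻¹ * q * qint (P.κ - i)) ∨
      ((i : ℤ) ≤ P.κ ∧ P.ζ = zetaMinus P.κ P.μ i ∧ κd' = P.κ1 - 2 ∧ κ1' = P.κd + 2 ∧
        β' = qbr P.μ (P.κ - 2 * i) ∧
        ζ' = P.μ⁻¹ * q ^ ((i : ℤ) + 2) * qint (i + 2)
          - P.μ * q ^ (P.κ - i + 2) * qint (P.κ - i + 2)) ∨
      (κd' = P.κd ∧ κ1' = P.κ1 ∧ β' = qbr P.μ 0 ∧ ζ' = P.ζ) := by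
  have hκ : P.κ = P.κd - P.κ1 := rfl
  constructor
  · rintro ⟨a, b, h1, h2, h3, hp, hm, h4⟩
    rw [cPlus_eq_zero_iff] at hp
    rw [cMinus_eq_zero_iff] at hm
    rcases a with _ | a <;> rcases b with _ | b
    · refine ⟨0, Or.inr (Or.inr (Or.inr ⟨by simpa using h1, by simpa using h2, by simpa using h3,
        ?_⟩))⟩
      rw [h4, Nat.cast_zero, zEigen_zero]
    · have hζ := hm.resolve_left (by omega)
      rw [Nat.cast_add, Nat.cast_one, add_sub_cancel_right] at hζ
      refine ⟨b, Or.inl ⟨hζ, by push_cast at h1; omega, by push_cast at h2; omega, ?_, ?_⟩⟩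
      · rw [h3]
        push_cast
        ring_nf
      · rw [h4, ← zEigen_minus hζ]
        push_cast
        rfl
    · have hζ := hp.resolve_left (by omega)
      rw [Nat.cast_add, Nat.cast_one, add_sub_cancel_right] at hζ
      refine ⟨a, Or.inr (Or.inl ⟨hζ, by push_cast at h1; omega, by push_cast at h2; omega, ?_, ?_⟩)⟩
      · rw [h3]
        push_cast
        ring_nf
      · rw [h4, ← zEigen_plus hζ]
        push_cast
        rfl
    · have hζ := hm.resolve_left (by omega)
      have hζ' := hp.resolve_left (by omega)
      rw [Nat.cast_add, Nat.cast_one, add_sub_cancel_right] at hζ hζ'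
      -- Both coefficients vanish away from the axes, so the indices add up to `κ`; this yields `i ≤
      -- κ` and turns `κ_◇ - κ - 2` into `κ_1 - 2`.
      have hab := add_eq_of_zeta_eq (hζ.symm.trans hζ')
      have ha : (a : ℤ) = P.κ - b := by omega
      refine ⟨b, Or.inr (Or.inr (Or.inl ⟨by omega, hζ, by push_cast at h1; omega,
        by push_cast at h2; omega, ?_, ?_⟩))⟩
      · rw [h3]
        push_cast
        rw [ha]
        ring_nf
      · rw [h4, ← zEigen_both hζ]
        push_cast
        rw [ha]
  · rintro ⟨i, ⟨hζ, rfl, rfl, rfl, rfl⟩ | ⟨hζ, rfl, rfl, rfl, rfl⟩ | ⟨hi, hζ, rfl, rfl, rfl, rfl⟩ |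
      ⟨rfl, rfl, rfl, rfl⟩⟩
    · refine ⟨0, i + 1, by push_cast; ring, by push_cast; ring, ?_,
        cPlus_eq_zero_iff.mpr (Or.inl rfl), cMinus_eq_zero_iff.mpr (Or.inr ?_), ?_⟩
      · push_cast
        rw [zero_sub]
      · rw [Nat.cast_add, Nat.cast_one, add_sub_cancel_right, hζ]
      · rw [← zEigen_minus hζ]
        push_cast
        rfl
    · refine ⟨i + 1, 0, by push_cast; ring, by push_cast; ring, ?_,
        cPlus_eq_zero_iff.mpr (Or.inr ?_), cMinus_eq_zero_iff.mpr (Or.inl rfl), ?_⟩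
      · push_cast
        rw [sub_zero]
      · rw [Nat.cast_add, Nat.cast_one, add_sub_cancel_right, hζ]
      · rw [← zEigen_plus hζ]
        push_cast
        rfl
    · obtain ⟨j, hj⟩ := Int.eq_ofNat_of_zero_le (sub_nonneg.mpr hi)
      refine ⟨j + 1, i + 1, by push_cast; omega, by push_cast; omega, ?_,
        cPlus_eq_zero_iff.mpr (Or.inr ?_), cMinus_eq_zero_iff.mpr (Or.inr ?_), ?_⟩
      · push_cast
        rw [← hj]
        ring_nf
      · rw [Nat.cast_add, Nat.cast_one, add_sub_cancel_right, ← hj, zetaPlus_sub, hζ]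
      · rw [Nat.cast_add, Nat.cast_one, add_sub_cancel_right, hζ]
      · rw [← zEigen_both hζ]
        push_cast
        rw [hj]
    · refine ⟨0, 0, by simp, by simp, by simp, cPlus_eq_zero_iff.mpr (Or.inl rfl),
        cMinus_eq_zero_iff.mpr (Or.inl rfl), ?_⟩
      rw [Nat.cast_zero, zEigen_zero]

end GoodWeight

end

end QSP

theorem theorem4p12 (κd κ1 κd' κ1' : ℤ) (μ ζ μ' ζ' : QSP.Kq)
    (hμ : μ ≠ 0) (hμ' : μ' ≠ 0) (hgood : QSP.IsGood μ) (κ : ℤ) (hκ : κ = κd - κ1) :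
    ((∃ φ : QSP.VermaHom κd' κ1' (QSP.qbr μ' 0) ζ' κd κ1 (QSP.qbr μ 0) ζ, φ ≠ 0) ↔
      ∃ i : ℕ,
        -- first case
        (ζ = μ * QSP.q ^ (-(i : ℤ)) * QSP.qint (κ - i)
              - μ⁻¹ * QSP.q ^ ((i : ℤ) - κ) * QSP.qint i ∧
          κd' = κd - i - 1 ∧
          κ1' = κ1 + i + 1 ∧
          QSP.qbr μ' 0 = QSP.qbr μ (-((i : ℤ) + 1)) ∧
          ζ' = μ * QSP.q * QSP.qint (κ - i)
              + μ⁻¹ * QSP.q ^ (2 * (i : ℤ) + 1 - κ) * QSP.qint (i + 2)) ∨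
        -- second case
        (ζ = μ * QSP.q ^ ((i : ℤ) - κ) * QSP.qint i
              - μ⁻¹ * QSP.q ^ (-(i : ℤ)) * QSP.qint (κ - i) ∧
          κd' = κd - i - 1 ∧
          κ1' = κ1 + i + 1 ∧
          QSP.qbr μ' 0 = QSP.qbr μ ((i : ℤ) + 1) ∧
          ζ' = -(μ * QSP.q ^ (2 * (i : ℤ) + 1 - κ) * QSP.qint (i + 2))
              - μ⁻¹ * QSP.q * QSP.qint (κ - i)) ∨
        -- third case
        ((i : ℤ) ≤ κ ∧
          ζ = μ * QSP.q ^ (-(i : ℤ)) * QSP.qint (κ - i)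
              - μ⁻¹ * QSP.q ^ ((i : ℤ) - κ) * QSP.qint i ∧
          κd' = κ1 - 2 ∧
          κ1' = κd + 2 ∧
          QSP.qbr μ' 0 = QSP.qbr μ (κ - 2 * i) ∧
          ζ' = μ⁻¹ * QSP.q ^ ((i : ℤ) + 2) * QSP.qint (i + 2)
              - μ * QSP.q ^ (κ - i + 2) * QSP.qint (κ - i + 2)) ∨
        -- fourth case: the two highest weights agree
        (κd' = κd ∧ κ1' = κ1 ∧ QSP.qbr μ' 0 = QSP.qbr μ 0 ∧ ζ' = ζ)) ∧
    ((∃ φ : QSP.VermaHom κd' κ1' (QSP.qbr μ' 0) ζ' κd κ1 (QSP.qbr μ 0) ζ, φ ≠ 0) →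
      Module.finrank QSP.Kq
        (QSP.VermaHom κd' κ1' (QSP.qbr μ' 0) ζ' κd κ1 (QSP.qbr μ 0) ζ) = 1) := by
  subst hκ
  have key := QSP.GoodWeight.exists_hom_iff ⟨κd, κ1, μ, ζ, hμ, hgood⟩
    (κd' := κd') (κ1' := κ1') (β' := QSP.qbr μ' 0) (ζ' := ζ')
  refine ⟨key.trans QSP.GoodWeight.exists_singularAt_iff, ?_⟩
  rintro ⟨φ, hφ⟩
  exact QSP.GoodWeight.finrank_hom ⟨κd, κ1, μ, ζ, hμ, hgood⟩ φ hφ
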